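/- **Notation.** A dyadic interval is $[m2^k,(m+1)2^k)$ with $k,m\in\mathbb Z$; $|J|$ and $c(J)$ denote the length and the center of an interval $J$, and $\omega_-$, $\omega_+$ denote the lower and upper dyadic halves of a dyadic interval $\omega$. A tile is a product $s=I_s\times\omega_s$ of dyadic intervals with $|I_s|\,|\omega_s|=1$. Write $s<s'$ if $\omega_s\supseteq\omega_{s'}$ and $I_s\subseteq I_{s'}$ (so $s<s$). A set $\mathbf T$ of tiles is a tree with top $I_{\mathbf T}\times\omega_{\mathbf T}$ (a tile, not necessarily in $\mathbf T$ and not unique) if $s<I_{\mathbf T}\times\omega_{\mathbf T}$ for all $s\in\mathbf T$; it is a $+$tree if moreover $(I_{\mathbf T}\times\omega_{\mathbf T})\cap(I_s\times\omega_{s+})\neq\emptyset$ for each $s\in\mathbf T$ other than the top. Write $\langle f,g\rangle=\int f\,\overline g\,dx$. Let $\nu$ be a real constant and $\varphi$ a complex-valued Schwartz function on $\mathbb R$ with $\int e^{-ix\xi}\varphi(x)\,dx=0$ for $|\xi|>1/\nu$. For a tile $s$ put $$\varphi_s(x)=e^{i\,c(\omega_{s-})x}\,|I_s|^{-1/2}\varphi\Big(\frac{x-c(I_s)}{|I_s|}\Big).$$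 Let $N:\mathbb R\to\mathbb R$ be measurable, let $(k_j)_{j\ge1}$ be an increasing sequence of integers, let $\alpha_j:\mathbb R\to\mathbb R$ be measurable with $\sum_{j\ge1}|\alpha_j(x)|^2\le1$ for all $x$, and let $\ell_{j-},\ell_{j+}:\mathbb R\to\mathbb Z$ be measurable with $k_j\le\ell_{j-}(x)<\ell_{j+}(x)<k_{j+1}$ for all $j$ and $x$. Put $$F_{s,j}=\{x:2^{\ell_{j-}(x)}\le|I_s|<2^{\ell_{j+}(x)}\},\qquad f_{s,j}(x)=\mathbf 1_{F_{s,j}}(x)\,\alpha_j(x)\,\mathbf 1_{\omega_{s+}}(N(x))\,\varphi_s(x).$$ Let $G,H\subseteq\mathbb R$ be measurable. With $\chi_I(x)=|I|^{-1}\big(1+|x-c(I)|/|I|\big)^{-\nu}$ define, for a set $\mathcal S$ of tiles, $$\operatorname{dense}(\mathcal S)=\sup_{s\in\mathcal S}\ \sup_{s'\text{ a tile},\ s<s'}\ \int_{N^{-1}(\omega_{s'})\cap H}\chi_{I_{s'}}\,dx,$$ $$\operatorname{size}(\mathcal S)=\sup\Big\{|I_{\mathbf T}|^{-1/2}\Big(\sum_{s\in\mathbf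 T}|\langle\mathbf 1_G,\varphi_s\rangle|^2\Big)^{1/2}:\ \mathbf T\subseteq\mathcal S\text{ a }+\text{tree}\Big\}$$ (suprema over the empty set being $0$). **Lemma 11 (Tree Lemma).** If $\nu$ is sufficiently large (larger than an absolute constant), then there is a constant $C$, depending only on $\nu$ and $\varphi$, such that for all choices of $N$, $(k_j)$, $(\alpha_j)$, $(\ell_{j\pm})$, $G$, $H$ as above, every tree $\mathbf T$ and every top $I_{\mathbf T}\times\omega_{\mathbf T}$ of $\mathbf T$, $$\sum_{j\ge1}\ \sum_{s\in\mathbf T}\big|\langle\mathbf 1_G,\varphi_s\rangle\,\langle\mathbf 1_H,f_{s,j}\rangle\big|\ \le\ C\,\operatorname{size}(\mathbf T)\,\operatorname{dense}(\mathbf T)\,|I_{\mathbf T}|.$$ -/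

import Mathlib

open MeasureTheory Set
open scoped ENNReal NNReal SchwartzMap ComplexConjugate

noncomputable section

namespace TimeFreq

/-- The modulation `Mod_ξ f (x) = e^{i x ξ} f(x)`. -/
def modulation (ξ : ℝ) (f : ℝ → ℂ) : ℝ → ℂ :=
  fun x => Complex.exp (Complex.I * x * ξ) * f x

/-- The translation `Tran_y f (x) = f(x - y)`. -/
def translation {E : Type*} (y : ℝ) (f : ℝ → E) : ℝ → E :=
  fun x => f (x - y)

/-- The `L^p`-normalized dilation `Dil^{(p)}_s f (x) = s^{-1/p} f(x/s)`, for `0 < s, p < ∞`. -/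
def dilation {E : Type*} [SMul ℝ E] (p s : ℝ) (f : ℝ → E) : ℝ → E :=
  fun x => s ^ (-1 / p) • f (x / s)

/-- The frequency support of `f`, for the Fourier transform `∫ e^{-i x ξ} f(x) dx` that matches
the modulations above, is contained in `[-r, r]`. -/
def FreqSupportedIn (f : ℝ → ℂ) (r : ℝ) : Prop :=
  ∀ ξ : ℝ, r < |ξ| → ∫ x : ℝ, Complex.exp (-(Complex.I * x * ξ)) * f x = 0

/-- The pairing `⟨f, g⟩ = ∫ f \bar g`. -/
def pairing (f g : ℝ → ℂ) : ℂ := ∫ x : ℝ, f x * conj (g x)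

/-- The indicator function of a set of reals, with complex values. -/
def ind (A : Set ℝ) : ℝ → ℂ := A.indicator (fun _ => (1 : ℂ))

/-- The dyadic interval `[m 2^k, (m+1) 2^k)`, encoded by the pair `(k, m)`. -/
structure DyadicInterval where
  /-- the exponent of the length -/
  k : ℤ
  /-- the position -/
  m : ℤ

namespace DyadicInterval

/-- The length `|I| = 2^k`. -/
def length (I : DyadicInterval) : ℝ := (2 : ℝ) ^ I.k

/-- The interval as a set of reals. -/
def toSet (I : DyadicInterval) : Set ℝ := Ico (I.m * I.length) ((I.m + 1) * I.length)

/-- The center `c(I)`. -/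
def center (I : DyadicInterval) : ℝ := (I.m + 1 / 2) * I.length

/-- The lower (left) dyadic half. -/
def lower (I : DyadicInterval) : DyadicInterval := ⟨I.k - 1, 2 * I.m⟩

/-- The upper (right) dyadic half. -/
def upper (I : DyadicInterval) : DyadicInterval := ⟨I.k - 1, 2 * I.m + 1⟩

end DyadicInterval

/-- A tile `I × ω`: a product of two dyadic intervals with `|ω| |I| = 1`. -/
structure Tile where
  /-- the spatial interval -/
  I : DyadicInterval
  /-- the frequency interval -/
  ω : DyadicInterval
  area : ω.length * I.length = 1

/-- The (reflexive) order on tiles, written `s < s'` in the literature: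
`ω_s ⊇ ω_{s'}` and `I_s ⊆ I_{s'}`. -/
def Tile.Below (s s' : Tile) : Prop :=
  s'.ω.toSet ⊆ s.ω.toSet ∧ s.I.toSet ⊆ s'.I.toSet

/-- `T` is a tree with top `t`. -/
def IsTree (T : Set Tile) (t : Tile) : Prop := ∀ s ∈ T, s.Below t

/-- `T` is a `+`tree with top `t`: it is a tree with top `t`, and for each `s ∈ T` aside from
the top, the rectangles `I_t × ω_t` and `I_s × ω_{s+}` intersect. -/
def IsPlusTree (T : Set Tile) (t : Tile) : Prop :=
  IsTree T t ∧ ∀ s ∈ T, s ≠ t →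
    ((t.I.toSet ×ˢ t.ω.toSet) ∩ (s.I.toSet ×ˢ s.ω.upper.toSet)).Nonempty

/-- The wave packet `φ_s = Mod_{c(ω_{s-})} Tran_{c(I_s)} Dil^{(2)}_{|I_s|} φ`. -/
def packet (φ : ℝ → ℂ) (s : Tile) : ℝ → ℂ :=
  modulation s.ω.lower.center (translation s.I.center (dilation 2 s.I.length φ))

/-- The set `F_{s,j} = {x : 2^{ℓ_{j-}(x)} ≤ |I_s| < 2^{ℓ_{j+}(x)}}`, for given functions
`lm = ℓ_{j-}` and `lp = ℓ_{j+}`. -/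
def scaleSet (lm lp : ℝ → ℤ) (s : Tile) : Set ℝ :=
  {x | (2 : ℝ) ^ lm x ≤ s.I.length ∧ s.I.length < (2 : ℝ) ^ lp x}

/-- The function `f_{s,j} = 1_{F_{s,j}} · α_j · 1_{ω_{s+}}(N) · φ_s`, for given functions
`N`, `a = α_j`, `lm = ℓ_{j-}` and `lp = ℓ_{j+}`. -/
def companion (φ : ℝ → ℂ) (N a : ℝ → ℝ) (lm lp : ℝ → ℤ) (s : Tile) : ℝ → ℂ :=
  fun x => ind (scaleSet lm lp s) x * (a x : ℂ) * (ind s.ω.upper.toSet (N x) * packet φ s x)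

/-- `χ_I = Tran_{c(I)} Dil^{(1)}_{|I|} χ`, where `χ(x) = (1 + |x|)^{-ν}`. -/
def bump (ν : ℝ) (I : DyadicInterval) : ℝ → ℝ :=
  translation I.center (dilation 1 I.length fun x : ℝ => (1 + |x|) ^ (-ν))

/-- The density of a tile: the supremum of `∫_{N⁻¹(ω_{s'}) ∩ H} χ_{I_{s'}}` over all tiles `s'`
above `s`. -/
def tileDensity (ν : ℝ) (N : ℝ → ℝ) (H : Set ℝ) (s : Tile) : ℝ≥0∞ :=
  ⨆ (s' : Tile) (_ : s.Below s'),
    ∫⁻ x in N ⁻¹' s'.ω.toSet ∩ H, ENNReal.ofReal (bump ν s'.I x)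

/-- The density of a set of tiles. -/
def density (ν : ℝ) (N : ℝ → ℝ) (H : Set ℝ) (S : Set Tile) : ℝ≥0∞ :=
  ⨆ s ∈ S, tileDensity ν N H s

/-- The size of a set `S` of tiles, relative to the function `f`: the supremum of
`|I_T|^{-1/2} (∑_{s ∈ T} |⟨f, φ_s⟩|²)^{1/2}` over all `+`trees `T ⊆ S`. -/
def size (φ f : ℝ → ℂ) (S : Set Tile) : ℝ≥0∞ :=
  ⨆ (T : Set Tile) (t : Tile) (_ : T ⊆ S) (_ : IsPlusTree T t),
    ENNReal.ofReal t.I.length ^ (-1 / 2 : ℝ) *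
      (∑' s : T, ‖pairing f (packet φ s)‖ₑ ^ 2) ^ (1 / 2 : ℝ)

/-- `Sum(S) = ∑_j ∑_{s ∈ S} |⟨1_G, φ_s⟩ ⟨1_H, f_{s,j}⟩|`. -/
def modelSum (φ : ℝ → ℂ) (N : ℝ → ℝ) (α : ℕ → ℝ → ℝ) (lm lp : ℕ → ℝ → ℤ) (G H : Set ℝ)
    (S : Set Tile) : ℝ≥0∞ :=
  ∑' (j : ℕ) (s : S), ‖pairing (ind G) (packet φ s) *
    pairing (ind H) (companion φ N (α j) (lm j) (lp j) s)‖ₑ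

end TimeFreq

end

/-!
The sum is split according to the position of `x` relative to the tree. For finitely many tiles
let `treeDist x` be the least value of `|I_s| + |x - c(I_s)|`; it is a positive `1`-Lipschitz
function which takes the place of the usual partition of the line into maximal dyadic intervals `J`
such that `3J` contains no `I_s`. For a tile `s`, a point `x` is far if `|I_s| ≤ 2 treeDist x` and
near otherwise.

*Far points* (`exists_far_le`). A coefficient is at most `size · |I_s|^{1/2}`, and the integral of
`|f_{s,j}|` is at most `density · |I_s|^{1/2}` times the spare decay of `φ_s` at the far points.
Averaging this decay over balls of radius comparable to `treeDist` turns the sum over `s` into an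
integral in `z`, to which only tiles with `|I_s| ≤ 4 treeDist z` contribute; the sum over their
scales is geometric.

*Near points.* The points that are near some tile `s` with `N x ∈ ω_s` form the active set. On the
ball around `z` of radius `treeDist z / 2` it is contained in `N⁻¹(ω_{s'})` for a single tile `s'`
above the tree with `|I_{s'}|` comparable to `treeDist z`, so its measure there is at most
`C · density · treeDist z` (`volume_activeSet_inter_le`), and an integral over the active set is at
most `C · density` times the integral over a multiple of `I_t` of any function that controls the
integrand on these balls (`lintegral_activeSet_le`). It remains to bound the integrand.

Let `ξ` be the left end of `ω_t`. For the tiles with `ξ ∉ ω_{s+}` the intervals `ω_{s+}` of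
different scales are disjoint, so that at each point a single scale contributes
(`exists_near_lower_le`).

The tiles with `ξ ∈ ω_{s+}` form a `+`tree. The spectra of their wave packets are disjoint for
different scales, so superpositions satisfy an `L²` bound (`exists_superpose_le`), and cutting off
small scales is a convolution with a kernel at the cutoff scale (`exists_truncate_le`). For given
`x` and `j` the tiles that contribute are those of a block of scales in `[k_j, k_{j+1})`, whose sum
is bounded by the maximal averages of the superposition over all scales in `[k_j, k_{j+1})`. By
`∑ |α_j|² ≤ 1` it is enough to sum the squares over `j`, which the `L²` maximal inequality
(`lintegral_iSup_kernelAvg_sq_le`) and orthogonality bound by `size² · |I_t|`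
(`exists_near_upper_le`).
-/

namespace TimeFreq

/-! ### Dyadic intervals and tiles -/

namespace DyadicInterval

lemma length_pos (I : DyadicInterval) : 0 < I.length := by
  unfold length; positivity

lemma mem_toSet_iff {I : DyadicInterval} {x : ℝ} : x ∈ I.toSet ↔ ⌊x / I.length⌋ = I.m := by
  have h := I.length_pos
  rw [toSet, mem_Ico, Int.floor_eq_iff, le_div_iff₀ h, div_lt_iff₀ h]

/-- The dyadic interval of length `2 ^ k` that contains `x`. -/
noncomputable def around (k : ℤ) (x : ℝ) : DyadicInterval := ⟨k, ⌊x / (2 : ℝ) ^ k⌋⟩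

@[simp] lemma length_around (k : ℤ) (x : ℝ) : (around k x).length = 2 ^ k := rfl

lemma mem_around (k : ℤ) (x : ℝ) : x ∈ (around k x).toSet := mem_toSet_iff.2 rfl

lemma eq_around_of_mem {I : DyadicInterval} {x : ℝ} (h : x ∈ I.toSet) : I = around I.k x := by
  have := mem_toSet_iff.1 h
  cases I
  simp only [around, length] at *
  rw [this]

lemma around_subset_around {k k' : ℤ} (h : k ≤ k') (x : ℝ) :
    (around k x).toSet ⊆ (around k' x).toSet := by
  intro y hy
  obtain ⟨n, rfl⟩ := Int.le.dest h
  have key : ∀ z : ℝ, ⌊z / (2 : ℝ) ^ (k + n)⌋ = ⌊z / (2 : ℝ) ^ k⌋ / ((2 ^ n : ℕ) : ℤ) := fun z => by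
    rw [← Int.floor_div_natCast, zpow_add₀ two_ne_zero, ← div_div]
    simp
  rw [mem_toSet_iff] at hy ⊢
  change ⌊y / (2 : ℝ) ^ k⌋ = ⌊x / (2 : ℝ) ^ k⌋ at hy
  change ⌊y / (2 : ℝ) ^ (k + n)⌋ = ⌊x / (2 : ℝ) ^ (k + n)⌋
  rw [key, key, hy]

lemma abs_sub_center_le {I : DyadicInterval} {x : ℝ} (h : x ∈ I.toSet) :
    |x - I.center| ≤ I.length / 2 := by
  have h0 := I.length_pos
  obtain ⟨h1, h2⟩ := h
  unfold center
  rw [abs_le]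
  constructor <;> nlinarith

lemma center_mem (I : DyadicInterval) : I.center ∈ I.toSet := by
  have h0 := I.length_pos
  constructor <;> unfold center <;> nlinarith

lemma left_mem (I : DyadicInterval) : I.m * I.length ∈ I.toSet :=
  ⟨le_rfl, by have := I.length_pos; nlinarith⟩

lemma length_lower (I : DyadicInterval) : I.lower.length = I.length / 2 := by
  simp only [lower, length]
  rw [zpow_sub_one₀ two_ne_zero, div_eq_mul_inv]

lemma length_upper (I : DyadicInterval) : I.upper.length = I.length / 2 := length_lower I

lemma center_lower (I : DyadicInterval) : I.lower.center = I.center - I.length / 4 := by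
  unfold center
  rw [length_lower]
  simp only [lower]
  push_cast
  ring

lemma mem_upper_iff {I : DyadicInterval} {x : ℝ} :
    x ∈ I.upper.toSet ↔ I.center ≤ x ∧ x < I.center + I.length / 2 := by
  rw [toSet, mem_Ico, length_upper]
  simp only [upper, center]
  push_cast
  constructor <;> rintro ⟨h1, h2⟩ <;> constructor <;> linarith

lemma upper_subset (I : DyadicInterval) : I.upper.toSet ⊆ I.toSet := by
  intro x hx
  rw [mem_upper_iff] at hx
  have h0 := I.length_pos
  simp only [center] at hx
  constructor <;> nlinarith [hx.1, hx.2]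

lemma mem_lower_iff {I : DyadicInterval} {x : ℝ} :
    x ∈ I.lower.toSet ↔ I.center - I.length / 2 ≤ x ∧ x < I.center := by
  rw [toSet, mem_Ico, length_lower]
  simp only [lower, center]
  push_cast
  constructor <;> rintro ⟨h1, h2⟩ <;> constructor <;> linarith

lemma mem_lower_of_notMem_upper {I : DyadicInterval} {x : ℝ} (h : x ∈ I.toSet)
    (h' : x ∉ I.upper.toSet) : x ∈ I.lower.toSet := by
  have h0 := abs_le.1 (abs_sub_center_le h)
  rw [mem_upper_iff, not_and, not_lt] at h'
  rw [mem_lower_iff]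
  refine ⟨by linarith [h0.1], ?_⟩
  by_contra hx
  have h1 := h' (not_lt.1 hx)
  have h2 := h.2
  simp only [center] at h1
  nlinarith

/-- The weight `1 + |x - c(I)| / |I|` that measures the distance from `x` to `I` in units
of `|I|`. -/
noncomputable def weight (I : DyadicInterval) (x : ℝ) : ℝ := 1 + |x - I.center| / I.length

lemma one_le_weight (I : DyadicInterval) (x : ℝ) : 1 ≤ I.weight x := by
  have := I.length_pos
  unfold weight
  have : 0 ≤ |x - I.center| / I.length := by positivity
  linarith

lemma weight_pos (I : DyadicInterval) (x : ℝ) : 0 < I.weight x :=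
  zero_lt_one.trans_le (I.one_le_weight x)

lemma length_mul_weight (I : DyadicInterval) (x : ℝ) :
    I.length * I.weight x = I.length + |x - I.center| := by
  have := I.length_pos
  unfold weight
  field_simp

lemma continuous_weight (I : DyadicInterval) : Continuous I.weight := by
  unfold weight
  fun_prop

lemma weight_le_two_mul_weight {I J : DyadicInterval} (h : I.toSet ⊆ J.toSet)
    (hl : I.length ≤ J.length) (x : ℝ) : J.weight x ≤ 2 * I.weight x := by
  have hI := I.length_pos
  have hJ := J.length_pos
  have h1 := abs_sub_center_le (h I.center_mem)
  have h2 : |x - J.center| ≤ |x - I.center| + J.length / 2 := by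
    calc |x - J.center| = |(x - I.center) + (I.center - J.center)| := by ring_nf
      _ ≤ _ := (abs_add_le _ _).trans (by linarith)
  have h3 : |x - I.center| / J.length ≤ |x - I.center| / I.length := by gcongr
  have h4 : |x - J.center| / J.length ≤ |x - I.center| / J.length + 1 / 2 := by
    rw [div_le_iff₀ hJ, add_mul, div_mul_cancel₀ _ hJ.ne']
    linarith
  have h5 : 0 ≤ |x - I.center| / I.length := by positivity
  unfold weight
  linarith

end DyadicInterval

open DyadicInterval

namespace Tile

lemma ω_k (s : Tile) : s.ω.k = -s.I.k := by
  have h := s.area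
  simp only [length] at h
  rw [← zpow_add₀ two_ne_zero] at h
  have h' := (zpow_eq_one_iff_right₀ (by norm_num : (0 : ℝ) ≤ 2) (by norm_num)).1 h
  omega

lemma length_ω (s : Tile) : s.ω.length = s.I.length⁻¹ :=
  eq_inv_of_mul_eq_one_left s.area

lemma ω_eq_around {s : Tile} {ξ : ℝ} (h : ξ ∈ s.ω.toSet) : s.ω = around (-s.I.k) ξ := by
  rw [← s.ω_k]; exact eq_around_of_mem h

lemma upper_eq_around {s : Tile} {ξ : ℝ} (h : ξ ∈ s.ω.upper.toSet) :
    s.ω.upper = around (-s.I.k - 1) ξ := by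
  rw [← s.ω_k]; exact eq_around_of_mem h

lemma ω_subset_upper_of_lt {s s' : Tile} {ξ : ℝ} (h : ξ ∈ s.ω.upper.toSet)
    (h' : ξ ∈ s'.ω.toSet) (hk : s.I.k < s'.I.k) : s'.ω.toSet ⊆ s.ω.upper.toSet := by
  rw [upper_eq_around h, ω_eq_around h']
  exact around_subset_around (by omega) ξ

lemma ω_subset_lower_of_lt {s s' : Tile} {ξ : ℝ} (h : ξ ∈ s.ω.toSet) (hu : ξ ∉ s.ω.upper.toSet)
    (h' : ξ ∈ s'.ω.toSet) (hk : s.I.k < s'.I.k) : s'.ω.toSet ⊆ s.ω.lower.toSet := by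
  have h1 : s.ω.lower = around (-s.I.k - 1) ξ := by
    rw [← s.ω_k]; exact eq_around_of_mem (mem_lower_of_notMem_upper h hu)
  rw [h1, ω_eq_around h']
  exact around_subset_around (by omega) ξ

/-- Among tiles whose frequency intervals share a point, a tile is determined by its spatial
interval. -/
lemma eq_of_I_eq {s s' : Tile} {ξ : ℝ} (h : ξ ∈ s.ω.toSet) (h' : ξ ∈ s'.ω.toSet)
    (hk : s.I.k = s'.I.k) (hm : s.I.m = s'.I.m) : s = s' := by
  have h1 : s.I = s'.I := by
    cases hs : s.I; cases hs' : s'.I; simp_all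
  have h2 : s.ω = s'.ω := by rw [ω_eq_around h, ω_eq_around h', hk]
  cases s; cases s'; simp_all

lemma Below.length_le {s s' : Tile} (h : s.Below s') : s.I.length ≤ s'.I.length := by
  by_contra hlt
  push Not at hlt
  -- otherwise `I_s` contains two points at distance `|I_{s'}|`
  have h2 : (s.I.m * s.I.length + s'.I.length) ∈ s.I.toSet :=
    ⟨by linarith [s'.I.length_pos], by linarith⟩
  have h3 := (h.2 h2).2
  have h4 := (h.2 s.I.left_mem).1
  linarith

end Tile

/-- At a given scale, the tiles of a tree are spread out in space, so that their weights are
summable. -/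
lemma exists_sum_weight_le : ∃ C : ℝ, 0 < C ∧ ∀ (T : Finset Tile) (ξ : ℝ) (k : ℤ),
    (∀ s ∈ T, ξ ∈ s.ω.toSet) → (∀ s ∈ T, s.I.k = k) → ∀ x,
    ∑ s ∈ T, ((s.I.weight x) ^ 2)⁻¹ ≤ C := by
  have hsum : Summable fun m : ℤ => 4 * ((1 + |(m : ℝ)|) ^ 2)⁻¹ := by
    apply Summable.mul_left
    have h2 : Summable fun m : ℤ => 1 / (m : ℝ) ^ 2 :=
      Real.summable_one_div_int_pow.2 (by norm_num)
    refine Summable.of_norm_bounded_eventually (g := fun m : ℤ => 1 / (m : ℝ) ^ 2) h2 ?_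
    rw [Filter.eventually_cofinite]
    refine (Set.finite_singleton (0 : ℤ)).subset fun m hm => ?_
    by_contra hm0
    apply hm
    have hm1 : (m : ℝ) ≠ 0 := by exact_mod_cast hm0
    have hpos : 0 < |(m : ℝ)| := abs_pos.2 hm1
    rw [Real.norm_of_nonneg (by positivity), one_div]
    apply inv_anti₀ (by positivity)
    rw [← sq_abs (m : ℝ)]
    gcongr
    linarith
  refine ⟨∑' m : ℤ, 4 * ((1 + |(m : ℝ)|) ^ 2)⁻¹, ?_, ?_⟩
  · refine hsum.tsum_pos (fun m => by positivity) 0 (by norm_num)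
  intro T ξ k hξ hk x
  set n : ℤ := ⌊x / 2 ^ k - 1 / 2⌋
  have hinj : Set.InjOn (fun s : Tile => n - s.I.m) T := by
    intro s hs s' hs' h
    exact Tile.eq_of_I_eq (hξ s hs) (hξ s' hs') ((hk s hs).trans (hk s' hs').symm)
      (by simpa using h)
  calc ∑ s ∈ T, ((s.I.weight x) ^ 2)⁻¹
      ≤ ∑ s ∈ T, 4 * ((1 + |((n - s.I.m : ℤ) : ℝ)|) ^ 2)⁻¹ := by
        refine Finset.sum_le_sum fun s hs => ?_
        have hl : s.I.length = 2 ^ k := by rw [← hk s hs]; rfl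
        have hp : (0 : ℝ) < 2 ^ k := by positivity
        have hw : s.I.weight x = 1 + |x / 2 ^ k - 1 / 2 - s.I.m| := by
          unfold weight
          rw [hl, ← abs_of_pos hp, ← abs_div, abs_of_pos hp, DyadicInterval.center, hl]
          congr 2
          field_simp
          ring
        have h1 : |((n - s.I.m : ℤ) : ℝ)| ≤ |x / 2 ^ k - 1 / 2 - s.I.m| + 1 := by
          have := Int.floor_le (x / 2 ^ k - 1 / 2)
          have := Int.lt_floor_add_one (x / 2 ^ k - 1 / 2)
          push_cast
          rw [abs_le]
          constructor
          · linarith [neg_abs_le (x / 2 ^ k - 1 / 2 - (s.I.m : ℝ))]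
          · linarith [le_abs_self (x / 2 ^ k - 1 / 2 - (s.I.m : ℝ))]
        rw [hw, inv_le_iff_one_le_mul₀ (by positivity)]
        rw [mul_assoc, mul_comm, mul_assoc, inv_mul_eq_div, one_le_div (by positivity)]
        have : (1 + |((n - s.I.m : ℤ) : ℝ)|) ≤ 2 * (1 + |x / 2 ^ k - 1 / 2 - s.I.m|) := by
          linarith [abs_nonneg (x / 2 ^ k - 1 / 2 - (s.I.m : ℝ))]
        calc _ ≤ (2 * (1 + |x / 2 ^ k - 1 / 2 - s.I.m|)) ^ 2 := by gcongr
          _ = _ := by ring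
    _ = ∑ m ∈ T.image (fun s : Tile => n - s.I.m), 4 * ((1 + |(m : ℝ)|) ^ 2)⁻¹ := by
        rw [Finset.sum_image hinj]
    _ ≤ _ := hsum.sum_le_tsum _ (fun m _ => by positivity)

/-- A sum of distinct powers of two is at most twice any bound for its terms. -/
lemma sum_two_zpow_le (S : Finset ℤ) : ∀ R : ℝ, 0 ≤ R → (∀ k ∈ S, (2 : ℝ) ^ k ≤ R) →
    ∑ k ∈ S, (2 : ℝ) ^ k ≤ 2 * R := by
  induction S using Finset.induction_on_max with
  | empty => intro R hR _; simpa using hR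
  | insert a S ha ih =>
    intro R _ hR
    rw [Finset.sum_insert (fun h => lt_irrefl _ (ha a h))]
    have h1 := ih ((2 : ℝ) ^ (a - 1)) (by positivity) fun k hk =>
      zpow_le_zpow_right₀ (by norm_num) (by have := ha k hk; omega)
    have h2 := hR a (Finset.mem_insert_self _ _)
    rw [zpow_sub_one₀ two_ne_zero] at h1
    linarith

/-! ### A maximal inequality -/

/-- The Cauchy–Schwarz inequality for the lower Lebesgue integral, in squared form. -/
lemma sq_lintegral_mul_le {α : Type*} [MeasurableSpace α] (μ : Measure α) {f g : α → ℝ≥0∞}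
    (hf : AEMeasurable f μ) (hg : AEMeasurable g μ) :
    (∫⁻ x, f x * g x ∂μ) ^ 2 ≤ (∫⁻ x, f x ^ 2 ∂μ) * ∫⁻ x, g x ^ 2 ∂μ := by
  have h := ENNReal.lintegral_mul_le_Lp_mul_Lq μ Real.HolderConjugate.two_two hf hg
  have h2 : ∀ y : ℝ≥0∞, (y ^ (1 / 2 : ℝ)) ^ 2 = y := fun y => by
    rw [← ENNReal.rpow_natCast, ← ENNReal.rpow_mul]; norm_num
  simp only [Pi.mul_apply, ENNReal.rpow_two] at h
  calc (∫⁻ x, f x * g x ∂μ) ^ 2 ≤ ((∫⁻ x, f x ^ 2 ∂μ) ^ (1 / 2 : ℝ) *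
      (∫⁻ x, g x ^ 2 ∂μ) ^ (1 / 2 : ℝ)) ^ 2 := by gcongr
    _ = _ := by rw [mul_pow, h2, h2]

/-- The kernel `r / (r + |u|)²`, comparable to the Poisson kernel at height `r`. -/
noncomputable def decayKernel (r u : ℝ) : ℝ := r / (r + |u|) ^ 2

lemma decayKernel_nonneg {r : ℝ} (hr : 0 < r) (u : ℝ) : 0 ≤ decayKernel r u := by
  unfold decayKernel; positivity

lemma decayKernel_neg (r u : ℝ) : decayKernel r (-u) = decayKernel r u := by
  simp [decayKernel]

lemma decayKernel_sub_comm (r x y : ℝ) : decayKernel r (x - y) = decayKernel r (y - x) := by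
  rw [← decayKernel_neg, neg_sub]

@[fun_prop]
lemma measurable_decayKernel {α : Type*} [MeasurableSpace α] {r u : α → ℝ} (hr : Measurable r)
    (hu : Measurable u) : Measurable fun a => decayKernel (r a) (u a) := by
  unfold decayKernel
  have : Measurable fun a => |u a| := by
    simpa [Real.norm_eq_abs] using hu.norm
  fun_prop

/-- The total mass of every kernel `decayKernel r`. -/
noncomputable def kernelMass : ℝ≥0∞ := ∫⁻ u : ℝ, ENNReal.ofReal (decayKernel 1 u)

lemma integrable_decayKernel_one : Integrable (decayKernel 1) := by
  have h := integrable_one_add_norm (E := ℝ) (μ := volume) (r := 2) (by simp)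
  refine h.congr (Filter.Eventually.of_forall fun x => ?_)
  simp only [decayKernel, Real.norm_eq_abs]
  rw [Real.rpow_neg (by positivity), Real.rpow_two, one_div]

lemma decayKernel_eq {r : ℝ} (hr : 0 < r) (u : ℝ) :
    decayKernel r u = r⁻¹ * decayKernel 1 (r⁻¹ * u) := by
  unfold decayKernel
  rw [abs_mul, abs_of_pos (inv_pos.2 hr)]
  have : 0 ≤ |u| := abs_nonneg u
  have h1 : r + |u| ≠ 0 := by positivity
  have h2 : 1 + r⁻¹ * |u| ≠ 0 := by positivity
  field_simp

lemma integrable_decayKernel {r : ℝ} (hr : 0 < r) : Integrable (decayKernel r) := by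
  have h := (integrable_decayKernel_one.comp_mul_left' (inv_pos.2 hr).ne').const_mul r⁻¹
  exact h.congr (Filter.Eventually.of_forall fun u => (decayKernel_eq hr u).symm)

lemma kernelMass_ne_top : kernelMass ≠ ⊤ := by
  unfold kernelMass
  rw [← ofReal_integral_eq_lintegral_ofReal integrable_decayKernel_one
    (Filter.Eventually.of_forall fun u => decayKernel_nonneg one_pos u)]
  exact ENNReal.ofReal_ne_top

lemma lintegral_decayKernel {r : ℝ} (hr : 0 < r) (c : ℝ) :
    ∫⁻ y, ENNReal.ofReal (decayKernel r (y - c)) = kernelMass := by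
  rw [lintegral_sub_right_eq_self (fun y => ENNReal.ofReal (decayKernel r y)) c]
  unfold kernelMass
  rw [← ofReal_integral_eq_lintegral_ofReal (integrable_decayKernel hr)
    (Filter.Eventually.of_forall fun u => decayKernel_nonneg hr u),
    ← ofReal_integral_eq_lintegral_ofReal integrable_decayKernel_one
    (Filter.Eventually.of_forall fun u => decayKernel_nonneg one_pos u)]
  congr 1
  simp_rw [fun u => decayKernel_eq hr u]
  rw [integral_const_mul, Measure.integral_comp_mul_left (decayKernel 1)]
  rw [inv_inv, abs_of_pos hr, smul_eq_mul, ← mul_assoc, inv_mul_cancel₀ hr.ne', one_mul]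

lemma lintegral_decayKernel' {r : ℝ} (hr : 0 < r) (c : ℝ) :
    ∫⁻ y, ENNReal.ofReal (decayKernel r (c - y)) = kernelMass := by
  simp_rw [decayKernel_sub_comm r c]
  exact lintegral_decayKernel hr c

lemma decayKernel_le_of_abs_le {r u v : ℝ} (hr : 0 < r) (h : |u| ≤ 2 * |v|) :
    decayKernel r v ≤ 4 * decayKernel r u := by
  unfold decayKernel
  have hu : 0 ≤ |u| := abs_nonneg u
  rw [mul_div_assoc', div_le_div_iff₀ (by positivity) (by positivity)]
  have : (r + |u|) ^ 2 ≤ (2 * (r + |v|)) ^ 2 := by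
    gcongr
    linarith
  nlinarith

lemma decayKernel_le_of_near {r u v : ℝ} (hr : 0 < r) (h : |u - v| ≤ r) :
    decayKernel r u ≤ 4 * decayKernel r v := by
  unfold decayKernel
  have hv : |v| ≤ |u| + r := by
    calc |v| = |u - (u - v)| := by ring_nf
      _ ≤ |u| + |u - v| := abs_sub _ _
      _ ≤ _ := by linarith
  have hu : 0 ≤ |u| := abs_nonneg u
  have hv' : 0 ≤ |v| := abs_nonneg v
  rw [mul_div_assoc', div_le_div_iff₀ (by positivity) (by positivity)]
  have : (r + |v|) ^ 2 ≤ (2 * (r + |u|)) ^ 2 := by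
    gcongr
    linarith
  nlinarith

lemma decayKernel_mul_le {r q : ℝ} (hr : 0 < r) (hq : 0 < q) (z w y : ℝ) :
    decayKernel r (z - y) * decayKernel q (w - y) ≤
      4 * decayKernel q (z - w) * decayKernel r (z - y) +
        4 * decayKernel r (z - w) * decayKernel q (w - y) := by
  have h1 := decayKernel_nonneg hr (z - y)
  have h2 := decayKernel_nonneg hq (w - y)
  have h3 := decayKernel_nonneg hr (z - w)
  have h4 := decayKernel_nonneg hq (z - w)
  have htri : |z - w| ≤ |z - y| + |w - y| := by
    rw [abs_sub_comm w y]; exact abs_sub_le z y w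
  rcases le_total |z - y| |w - y| with h | h
  · have := decayKernel_le_of_abs_le hq (show |z - w| ≤ 2 * |w - y| by linarith)
    nlinarith [mul_nonneg h3 h2, mul_le_mul_of_nonneg_left this h1]
  · have := decayKernel_le_of_abs_le hr (show |z - w| ≤ 2 * |z - y| by linarith)
    nlinarith [mul_nonneg h4 h1, mul_le_mul_of_nonneg_right this h2]

lemma lintegral_decayKernel_mul_le {r q : ℝ} (hr : 0 < r) (hq : 0 < q) (z w : ℝ) :
    ∫⁻ y, ENNReal.ofReal (decayKernel r (z - y)) * ENNReal.ofReal (decayKernel q (w - y)) ≤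
      4 * kernelMass * (ENNReal.ofReal (decayKernel q (z - w)) +
        ENNReal.ofReal (decayKernel r (z - w))) := by
  have h3 := decayKernel_nonneg hr (z - w)
  have h4 := decayKernel_nonneg hq (z - w)
  calc ∫⁻ y, ENNReal.ofReal (decayKernel r (z - y)) * ENNReal.ofReal (decayKernel q (w - y))
      ≤ ∫⁻ y, (ENNReal.ofReal (4 * decayKernel q (z - w)) * ENNReal.ofReal (decayKernel r (z - y))
        + ENNReal.ofReal (4 * decayKernel r (z - w)) * ENNReal.ofReal (decayKernel q (w - y))) := by
        refine lintegral_mono fun y => ?_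
        dsimp only
        rw [← ENNReal.ofReal_mul (decayKernel_nonneg hr _), ← ENNReal.ofReal_mul (by positivity),
          ← ENNReal.ofReal_mul (by positivity), ← ENNReal.ofReal_add
            (mul_nonneg (by positivity) (decayKernel_nonneg hr _))
            (mul_nonneg (by positivity) (decayKernel_nonneg hq _))]
        exact ENNReal.ofReal_le_ofReal (decayKernel_mul_le hr hq z w y)
    _ = _ := by
        rw [lintegral_add_left (by fun_prop), lintegral_const_mul _ (by fun_prop),
          lintegral_const_mul _ (by fun_prop), lintegral_decayKernel' hr, lintegral_decayKernel' hq,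
          ENNReal.ofReal_mul (by norm_num), ENNReal.ofReal_mul (by norm_num)]
        simp only [ENNReal.ofReal_ofNat]
        ring

/-- The average of `f` around `z` against the kernel `decayKernel r`. -/
noncomputable def kernelAvg (r : ℝ) (f : ℝ → ℝ≥0∞) (z : ℝ) : ℝ≥0∞ :=
  ∫⁻ y, ENNReal.ofReal (decayKernel r (z - y)) * f y

lemma measurable_kernelAvg {r : ℝ → ℝ} (hr : Measurable r) {f : ℝ → ℝ≥0∞} (hf : Measurable f) :
    Measurable fun z => kernelAvg (r z) f z := by
  unfold kernelAvg
  have : Measurable (Function.uncurry fun z y : ℝ =>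
      ENNReal.ofReal (decayKernel (r z) (z - y)) * f y) := by
    simp only [Function.uncurry_def]
    fun_prop
  exact this.lintegral_prod_right

/-- Schur's bound for a single average. -/
lemma lintegral_kernelAvg_sq_le {r : ℝ} (hr : 0 < r) {f : ℝ → ℝ≥0∞} (hf : Measurable f) :
    ∫⁻ z, kernelAvg r f z ^ 2 ≤ kernelMass ^ 2 * ∫⁻ y, f y ^ 2 := by
  have hK : ∀ z, Measurable fun y : ℝ => ENNReal.ofReal (decayKernel r (z - y)) := by
    intro z; fun_prop
  have h1 : ∀ z, kernelAvg r f z ^ 2 ≤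
      kernelMass * ∫⁻ y, ENNReal.ofReal (decayKernel r (z - y)) * f y ^ 2 := by
    intro z
    have h := sq_lintegral_mul_le
      (volume.withDensity fun y : ℝ => ENNReal.ofReal (decayKernel r (z - y)))
      (f := fun _ => 1) (g := f) aemeasurable_const hf.aemeasurable
    rw [lintegral_withDensity_eq_lintegral_mul _ (hK z) (by fun_prop),
      lintegral_withDensity_eq_lintegral_mul _ (hK z) (by fun_prop),
      lintegral_withDensity_eq_lintegral_mul _ (hK z) (by fun_prop)] at h
    simpa [kernelAvg, lintegral_decayKernel' hr z] using h
  have hm : Measurable (Function.uncurry fun z y : ℝ =>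
      ENNReal.ofReal (decayKernel r (z - y)) * f y ^ 2) := by
    simp only [Function.uncurry_def]
    fun_prop
  calc ∫⁻ z, kernelAvg r f z ^ 2
      ≤ ∫⁻ z, kernelMass * ∫⁻ y, ENNReal.ofReal (decayKernel r (z - y)) * f y ^ 2 :=
        lintegral_mono h1
    _ = kernelMass * ∫⁻ y, ∫⁻ z, ENNReal.ofReal (decayKernel r (z - y)) * f y ^ 2 := by
        rw [lintegral_const_mul' _ _ kernelMass_ne_top, lintegral_lintegral_swap hm.aemeasurable]
    _ = kernelMass * ∫⁻ y, kernelMass * f y ^ 2 := by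
        congr 1
        refine lintegral_congr fun y => ?_
        rw [lintegral_mul_const _ (by fun_prop), lintegral_decayKernel hr]
    _ = _ := by
        rw [lintegral_const_mul' _ _ kernelMass_ne_top, ← mul_assoc, sq]

/-- The linearized maximal inequality, by the `T T*` method: if `T f (z)` is the average of `f` at
a measurably chosen radius `r z`, then the kernel of `T T*` is dominated by the sum of the kernels
of `T` and `T*`, so that `‖T*‖² ≤ C ‖T*‖`. The hypothesis on `B` only serves to make all norms
finite beforehand; it does not enter the bound. -/
lemma lintegral_kernelAvg_radius_sq_le {r : ℝ → ℝ} (hr : Measurable r) (hr0 : ∀ z, 0 < r z)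
    {B : ℝ} (hB : ∀ z u, decayKernel (r z) u ≤ B * decayKernel 1 u)
    {f : ℝ → ℝ≥0∞} (hf : Measurable f) (hf2 : ∫⁻ y, f y ^ 2 ≠ ⊤) :
    ∫⁻ z, kernelAvg (r z) f z ^ 2 ≤ (8 * kernelMass) ^ 2 * ∫⁻ y, f y ^ 2 := by
  have hB0 : 0 ≤ B := by
    have h1 := (decayKernel_nonneg (hr0 0) 0).trans (hB 0 0)
    have h2 : decayKernel 1 0 = 1 := by simp [decayKernel]
    rwa [h2, mul_one] at h1
  have hB' : ∀ z u, ENNReal.ofReal (decayKernel (r z) u) ≤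
      ENNReal.ofReal B * ENNReal.ofReal (decayKernel 1 u) := fun z u => by
    rw [← ENNReal.ofReal_mul hB0]; exact ENNReal.ofReal_le_ofReal (hB z u)
  set K : ℝ → ℝ → ℝ≥0∞ := fun z y => ENNReal.ofReal (decayKernel (r z) (z - y)) with hK
  have hKm : Measurable (Function.uncurry K) := by
    simp only [Function.uncurry_def, hK]
    fun_prop
  set u : ℝ → ℝ≥0∞ := fun z => ∫⁻ y, K z y * f y with hu
  have hum : Measurable u := measurable_kernelAvg hr hf
  set v : ℝ → ℝ≥0∞ := fun y => ∫⁻ z, K z y * u z with hv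
  have hvm : Measurable v := by
    have : Measurable (Function.uncurry fun y z => K z y * u z) := by
      simp only [Function.uncurry_def, hK]
      fun_prop
    exact this.lintegral_prod_right
  set X := ∫⁻ z, u z ^ 2 with hX
  set Y := ∫⁻ y, v y ^ 2 with hY
  set Z := ∫⁻ y, f y ^ 2 with hZ
  have finite_of_le : ∀ g h : ℝ → ℝ≥0∞, Measurable h → ∫⁻ y, h y ^ 2 ≠ ⊤ →
      (∀ z, g z ≤ ENNReal.ofReal B * kernelAvg 1 h z) → ∫⁻ z, g z ^ 2 ≠ ⊤ := by
    intro g h hh hfin hle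
    have : ∫⁻ z, g z ^ 2 ≤ ENNReal.ofReal B ^ 2 * (kernelMass ^ 2 * ∫⁻ y, h y ^ 2) := by
      calc ∫⁻ z, g z ^ 2 ≤ ∫⁻ z, ENNReal.ofReal B ^ 2 * kernelAvg 1 h z ^ 2 := by
            refine lintegral_mono fun z => ?_
            dsimp only
            rw [← mul_pow]
            gcongr
            exact hle z
        _ = ENNReal.ofReal B ^ 2 * ∫⁻ z, kernelAvg 1 h z ^ 2 :=
            lintegral_const_mul' _ _ (by finiteness)
        _ ≤ _ := by gcongr; exact lintegral_kernelAvg_sq_le one_pos hh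
    refine ne_top_of_le_ne_top ?_ this
    have := kernelMass_ne_top
    finiteness
  have hXfin : X ≠ ⊤ := by
    refine finite_of_le u f hf hf2 fun z => ?_
    unfold kernelAvg
    rw [← lintegral_const_mul' _ _ (by finiteness)]
    refine lintegral_mono fun y => ?_
    dsimp only
    rw [← mul_assoc]
    gcongr
    exact hB' z _
  have hYfin : Y ≠ ⊤ := by
    refine finite_of_le v u hum hXfin fun y => ?_
    unfold kernelAvg
    rw [← lintegral_const_mul' _ _ (by finiteness)]
    refine lintegral_mono fun z => ?_
    dsimp only
    rw [← mul_assoc, decayKernel_sub_comm 1 y z]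
    gcongr
    exact hB' z _
  -- `‖T f‖² = ⟨f, T* T f⟩`
  have hXY : X = ∫⁻ y, f y * v y := by
    calc X = ∫⁻ z, ∫⁻ y, u z * (K z y * f y) := by
          refine lintegral_congr fun z => ?_
          rw [lintegral_const_mul _ (by fun_prop), sq]
      _ = ∫⁻ y, ∫⁻ z, u z * (K z y * f y) := by
          refine lintegral_lintegral_swap (Measurable.aemeasurable ?_)
          simp only [Function.uncurry_def]
          fun_prop
      _ = _ := by
          refine lintegral_congr fun y => ?_
          rw [← lintegral_const_mul _ (by fun_prop)]
          refine lintegral_congr fun z => ?_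
          ring
  have hW : ∫⁻ z, ∫⁻ w, u z * u w * K z w = ∫⁻ w, u w * v w := by
    rw [lintegral_lintegral_swap (by
      refine Measurable.aemeasurable ?_
      simp only [Function.uncurry_def]
      fun_prop)]
    refine lintegral_congr fun w => ?_
    rw [← lintegral_const_mul _ (by fun_prop)]
    refine lintegral_congr fun z => ?_
    ring
  have hYW : Y ≤ 8 * kernelMass * ∫⁻ w, u w * v w := by
    calc Y = ∫⁻ y, ∫⁻ z, ∫⁻ w, u z * u w * (K z y * K w y) := by
          refine lintegral_congr fun y => ?_
          rw [sq, hv]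
          dsimp only
          rw [← lintegral_mul_const _ (by fun_prop)]
          refine lintegral_congr fun z => ?_
          rw [← lintegral_const_mul _ (by fun_prop)]
          refine lintegral_congr fun w => ?_
          ring
      _ = ∫⁻ z, ∫⁻ y, ∫⁻ w, u z * u w * (K z y * K w y) := by
          refine lintegral_lintegral_swap (Measurable.aemeasurable ?_)
          simp only [Function.uncurry_def]
          have : Measurable (fun p : (ℝ × ℝ) × ℝ =>
              u p.1.2 * u p.2 * (K p.1.2 p.1.1 * K p.2 p.1.1)) := by fun_prop
          exact this.lintegral_prod_right'
      _ = ∫⁻ z, ∫⁻ w, u z * u w * ∫⁻ y, K z y * K w y := by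
          refine lintegral_congr fun z => ?_
          rw [lintegral_lintegral_swap (by
            refine Measurable.aemeasurable ?_
            simp only [Function.uncurry_def]
            fun_prop)]
          refine lintegral_congr fun w => ?_
          rw [lintegral_const_mul _ (by fun_prop)]
      _ ≤ ∫⁻ z, ∫⁻ w, (4 * kernelMass * (u w * u z * K w z) +
            4 * kernelMass * (u z * u w * K z w)) := by
          refine lintegral_mono fun z => lintegral_mono fun w => ?_
          dsimp only
          calc u z * u w * ∫⁻ y, K z y * K w y
              ≤ u z * u w * (4 * kernelMass * (K w z + K z w)) := by
                gcongr
                have := lintegral_decayKernel_mul_le (hr0 z) (hr0 w) z w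
                rwa [decayKernel_sub_comm (r w) z w] at this
            _ = _ := by ring
      _ = 4 * kernelMass * (∫⁻ z, ∫⁻ w, u w * u z * K w z) +
            4 * kernelMass * (∫⁻ z, ∫⁻ w, u z * u w * K z w) := by
          have hm1 : Measurable fun p : ℝ × ℝ => u p.2 * u p.1 * K p.2 p.1 := by fun_prop
          have hm2 : Measurable fun p : ℝ × ℝ => u p.1 * u p.2 * K p.1 p.2 := by fun_prop
          rw [← lintegral_const_mul _ hm1.lintegral_prod_right',
            ← lintegral_const_mul _ hm2.lintegral_prod_right', ← lintegral_add_left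
            (hm1.lintegral_prod_right'.const_mul _)]
          refine lintegral_congr fun z => ?_
          rw [lintegral_add_left (by fun_prop), lintegral_const_mul _ (by fun_prop),
            lintegral_const_mul _ (by fun_prop)]
      _ = _ := by
          rw [lintegral_lintegral_swap (f := fun z w => u w * u z * K w z) (by
            refine Measurable.aemeasurable ?_
            simp only [Function.uncurry_def]
            fun_prop), hW]
          ring
  have h1 : Y ^ 2 ≤ (8 * kernelMass) ^ 2 * (X * Y) := by
    calc Y ^ 2 ≤ (8 * kernelMass * ∫⁻ w, u w * v w) ^ 2 := by gcongr
      _ = (8 * kernelMass) ^ 2 * (∫⁻ w, u w * v w) ^ 2 := by ring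
      _ ≤ _ := by gcongr; exact sq_lintegral_mul_le _ hum.aemeasurable hvm.aemeasurable
  have h2 : Y ≤ (8 * kernelMass) ^ 2 * X := by
    rcases eq_or_ne Y 0 with h0 | h0
    · simp [h0]
    · rw [← ENNReal.mul_le_mul_iff_left h0 hYfin]
      calc Y * Y = Y ^ 2 := by ring
        _ ≤ _ := h1
        _ = _ := by ring
  have h3 : X ^ 2 ≤ Z * Y := by
    rw [hXY]
    exact sq_lintegral_mul_le _ hf.aemeasurable hvm.aemeasurable
  change X ≤ _
  rcases eq_or_ne X 0 with h0 | h0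
  · simp [h0]
  · rw [← ENNReal.mul_le_mul_iff_left h0 hXfin]
    calc X * X = X ^ 2 := by ring
      _ ≤ Z * Y := h3
      _ ≤ Z * ((8 * kernelMass) ^ 2 * X) := by gcongr
      _ = _ := by ring

/-- A finite family of measurable functions attains its pointwise maximum at a measurably chosen
index. -/
lemma exists_measurable_argmax {ι : Type*} {S : Finset ι} (hS : S.Nonempty)
    {F : ι → ℝ → ℝ≥0∞} (hF : ∀ i, Measurable (F i)) (r : ι → ℝ) :
    ∃ a : ℝ → ι, Measurable (fun z => r (a z)) ∧ Measurable (fun z => F (a z) z) ∧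
      (∀ z, a z ∈ S) ∧ ∀ z, ∀ i ∈ S, F i z ≤ F (a z) z := by
  classical
  induction hS using Finset.Nonempty.cons_induction with
  | singleton i => exact ⟨fun _ => i, measurable_const, hF i, by simp, by simp⟩
  | cons i S hi hS ih =>
    obtain ⟨a, ha, hFa, haS, hmax⟩ := ih
    have hE : MeasurableSet {z | F (a z) z ≤ F i z} := measurableSet_le hFa (hF i)
    refine ⟨fun z => if F (a z) z ≤ F i z then i else a z, ?_, ?_, ?_, ?_⟩
    · simp_rw [apply_ite r]
      exact Measurable.ite hE measurable_const ha
    · have : (fun z => F (if F (a z) z ≤ F i z then i else a z) z) =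
          fun z => if F (a z) z ≤ F i z then F i z else F (a z) z := by
        ext z; split_ifs <;> rfl
      rw [this]
      exact Measurable.ite hE (hF i) hFa
    · intro z
      dsimp only
      split_ifs
      · simp
      · exact Finset.mem_cons_of_mem (haS z)
    · intro z j hj
      rcases Finset.mem_cons.1 hj with rfl | hj
      · dsimp only
        split_ifs with h
        · exact le_rfl
        · exact (not_le.1 h).le
      · dsimp only
        split_ifs with h
        · exact (hmax z j hj).trans h
        · exact hmax z j hj

/-- The maximal inequality on `L²` for the averages at finitely many radii `2 ^ a`. -/
lemma lintegral_iSup_kernelAvg_sq_le (S : Finset ℤ) {f : ℝ → ℝ≥0∞} (hf : Measurable f)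
    (hf2 : ∫⁻ y, f y ^ 2 ≠ ⊤) :
    ∫⁻ z, (⨆ a ∈ S, kernelAvg ((2 : ℝ) ^ a) f z) ^ 2 ≤
      (8 * kernelMass) ^ 2 * ∫⁻ y, f y ^ 2 := by
  rcases S.eq_empty_or_nonempty with rfl | hS
  · simp
  obtain ⟨a, ha, -, haS, hmax⟩ := exists_measurable_argmax hS
    (F := fun a : ℤ => kernelAvg ((2 : ℝ) ^ a) f)
    (fun i => measurable_kernelAvg measurable_const hf) (fun a => (2 : ℝ) ^ a)
  have hpos : ∀ k : ℤ, (0 : ℝ) < 2 ^ k := fun k => by positivity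
  refine le_trans (lintegral_mono fun z => ?_) (lintegral_kernelAvg_radius_sq_le
    (r := fun z => (2 : ℝ) ^ a z) ha (fun z => hpos _)
    (B := ∑ k ∈ S, ((2 : ℝ) ^ k + ((2 : ℝ) ^ k)⁻¹)) (fun z u => ?_) hf hf2)
  · dsimp only
    gcongr
    exact iSup₂_le fun i hi => hmax z i hi
  · have h1 : (2 : ℝ) ^ a z + ((2 : ℝ) ^ a z)⁻¹ ≤ ∑ k ∈ S, ((2 : ℝ) ^ k + ((2 : ℝ) ^ k)⁻¹) :=
      Finset.single_le_sum (f := fun k : ℤ => (2 : ℝ) ^ k + ((2 : ℝ) ^ k)⁻¹)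
        (fun k _ => by have := hpos k; positivity) (haS z)
    refine le_trans ?_ (mul_le_mul_of_nonneg_right h1 (decayKernel_nonneg one_pos u))
    generalize hρ : (2 : ℝ) ^ a z = ρ
    have hρ0 : 0 < ρ := by rw [← hρ]; exact hpos _
    have hu : 0 ≤ |u| := abs_nonneg u
    unfold decayKernel
    rw [mul_one_div, div_le_div_iff₀ (by positivity) (by positivity)]
    have h3 : (ρ + ρ⁻¹) * (ρ + |u|) ^ 2 =
        ρ * (ρ + |u|) ^ 2 + ρ + 2 * |u| + ρ⁻¹ * |u| ^ 2 := by
      field_simp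
      ring
    have h4 : ρ * |u| ^ 2 ≤ ρ * (ρ + |u|) ^ 2 := by
      gcongr; linarith
    rcases le_total ρ 1 with h | h
    · have : ρ * |u| ≤ 1 * |u| := by gcongr
      have : 0 ≤ ρ⁻¹ * |u| ^ 2 := by positivity
      rw [h3]; nlinarith
    · have : 1 * ρ * (1 + |u|) ^ 2 ≤ ρ * (ρ + |u|) ^ 2 := by
        rw [one_mul]; gcongr
      have : 0 ≤ ρ⁻¹ * |u| ^ 2 := by positivity
      rw [h3]; nlinarith

/-! ### Band-limited functions -/

section BandLimited

open scoped FourierTransform Convolution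
open ContinuousLinearMap (mul)

/-- The Fourier transform `∫ e^{-ixθ} f(x) dx`, in the angular normalization. -/
noncomputable def angularFourier (f : ℝ → ℂ) (θ : ℝ) : ℂ :=
  ∫ x : ℝ, Complex.exp (-(Complex.I * x * θ)) * f x

lemma fourier_eq_angularFourier (f : ℝ → ℂ) (w : ℝ) :
    𝓕 f w = angularFourier f (2 * Real.pi * w) := by
  rw [Real.fourier_real_eq_integral_exp_smul]
  unfold angularFourier
  congr 1
  ext x
  rw [smul_eq_mul]
  congr 2
  push_cast
  ring

lemma angularFourier_eq_fourier (f : ℝ → ℂ) (θ : ℝ) :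
    angularFourier f θ = 𝓕 f (θ / (2 * Real.pi)) := by
  rw [fourier_eq_angularFourier, mul_div_cancel₀ _ (by positivity)]

lemma angularFourier_modulated (g : ℝ → ℂ) (b c θ : ℝ) {L : ℝ} (hL : 0 < L) :
    angularFourier (fun y : ℝ => Complex.exp (Complex.I * y * c) * g ((y - b) / L)) θ =
      Complex.exp (-(Complex.I * b * (θ - c))) * L * angularFourier g (L * (θ - c)) := by
  unfold angularFourier
  set F : ℝ → ℂ := fun u =>
    Complex.exp (-(Complex.I * (L * u + b) * (θ - c))) * g u with hF
  have h1 : ∀ y : ℝ, Complex.exp (-(Complex.I * y * θ)) *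
      (Complex.exp (Complex.I * y * c) * g ((y - b) / L)) = F ((y - b) / L) := by
    intro y
    rw [← mul_assoc, ← Complex.exp_add, hF]
    dsimp only
    congr 2
    have : (L : ℂ) ≠ 0 := by exact_mod_cast hL.ne'
    push_cast
    field_simp
    ring
  simp_rw [h1]
  rw [integral_sub_right_eq_self (fun y => F (y / L)) b, Measure.integral_comp_div F L,
    abs_of_pos hL, Complex.real_smul, mul_comm (Complex.exp _) (L : ℂ), mul_assoc]
  congr 1
  rw [← integral_const_mul]
  refine integral_congr_ae (Filter.Eventually.of_forall fun u => ?_)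
  simp only [hF]
  rw [← mul_assoc, ← Complex.exp_add]
  congr 2
  push_cast
  ring

lemma eq_zero_of_angularFourier_eq_zero {f : ℝ → ℂ} (hc : Continuous f) (hi : Integrable f)
    (h : ∀ θ, angularFourier f θ = 0) : f = 0 := by
  have h0 : 𝓕 f = 0 := by
    ext w; rw [fourier_eq_angularFourier, h]; rfl
  have h1 := hc.fourierInv_fourier_eq hi (by rw [h0]; exact integrable_zero _ _ _)
  rw [← h1, h0]
  ext w
  simp [Real.fourierInv_eq]

section Convolution

variable {f K : ℝ → ℂ}

lemma angularFourier_convolution (hf : Integrable f) (hK : Integrable K) (θ : ℝ) :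
    angularFourier (fun x => ∫ y, f y * K (x - y)) θ =
      angularFourier f θ * angularFourier K θ := by
  simp_rw [angularFourier_eq_fourier]
  exact Real.fourier_mul_convolution_eq hf hK _

lemma integrable_convolution (hf : Integrable f) (hK : Integrable K) :
    Integrable fun x => ∫ y, f y * K (x - y) :=
  hf.integrable_convolution (mul ℂ ℂ) hK

lemma continuous_convolution (hf : Integrable f) (hK : Continuous K) {B : ℝ}
    (hB : ∀ y, ‖K y‖ ≤ B) : Continuous fun x => ∫ y, f y * K (x - y) :=
  BddAbove.continuous_convolution_right_of_integrable (mul ℂ ℂ)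
    ⟨B, by rintro _ ⟨y, rfl⟩; exact hB y⟩ hf hK

/-- Convolution with a kernel whose Fourier transform is `1` on the spectrum of `f` reproduces
`f`. -/
lemma convolution_eq_self (hf : Integrable f) (hfc : Continuous f) (hK : Integrable K)
    (hKc : Continuous K) {B : ℝ} (hB : ∀ y, ‖K y‖ ≤ B)
    (h : ∀ θ, angularFourier f θ = 0 ∨ angularFourier K θ = 1) (x : ℝ) :
    ∫ y, f y * K (x - y) = f x := by
  have hi := integrable_convolution hf hK
  have := eq_zero_of_angularFourier_eq_zero ((continuous_convolution hf hKc hB).sub hfc)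
    (hi.sub hf) fun θ => by
      have h1 : 𝓕 ((fun x => ∫ y, f y * K (x - y)) - f) (θ / (2 * Real.pi)) =
          𝓕 (fun x => ∫ y, f y * K (x - y)) (θ / (2 * Real.pi)) - 𝓕 f (θ / (2 * Real.pi)) := by
        simp_rw [Real.fourier_real_eq, Pi.sub_apply, smul_sub]
        have hc : ∀ (g : ℝ → ℂ) (w : ℝ), Integrable g →
            Integrable fun v : ℝ => Real.fourierChar (-(v * w)) • g v := fun g w hg => by
          have := (Real.fourierIntegral_convergent_iff (μ := volume) (f := g) w).2 hg
          simpa [mul_comm] using this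
        exact integral_sub (hc _ _ hi) (hc _ _ hf)
      change angularFourier ((fun x => ∫ y, f y * K (x - y)) - f) θ = 0
      rw [angularFourier_eq_fourier, h1, ← angularFourier_eq_fourier, ← angularFourier_eq_fourier,
        angularFourier_convolution hf hK]
      rcases h θ with h | h <;> simp [h]
  exact sub_eq_zero.1 (congrFun this x)

/-- Convolution with a kernel whose Fourier transform vanishes on the spectrum of `f` gives
zero. -/
lemma convolution_eq_zero (hf : Integrable f) (hK : Integrable K)
    (hKc : Continuous K) {B : ℝ} (hB : ∀ y, ‖K y‖ ≤ B)
    (h : ∀ θ, angularFourier f θ = 0 ∨ angularFourier K θ = 0) (x : ℝ) :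
    ∫ y, f y * K (x - y) = 0 := by
  have := eq_zero_of_angularFourier_eq_zero (continuous_convolution hf hKc hB)
    (integrable_convolution hf hK) fun θ => by
      rw [angularFourier_convolution hf hK]
      rcases h θ with h | h <;> simp [h]
  exact congrFun this x

lemma angularFourier_conj_neg (f : ℝ → ℂ) (θ : ℝ) :
    angularFourier (fun y => conj (f (-y))) θ = conj (angularFourier f θ) := by
  unfold angularFourier
  rw [← integral_conj, ← integral_neg_eq_self]
  congr 1
  ext y
  rw [map_mul, ← Complex.exp_conj]
  dsimp only
  rw [neg_neg]
  congr 2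
  simp

/-- Functions with disjoint spectra are orthogonal. -/
lemma integral_mul_conj_eq_zero {g : ℝ → ℂ} (hf : Integrable f) (hg : Integrable g)
    (hgc : Continuous g) {B : ℝ} (hB : ∀ y, ‖g y‖ ≤ B)
    (h : ∀ θ, angularFourier f θ = 0 ∨ angularFourier g θ = 0) :
    ∫ y, f y * conj (g y) = 0 := by
  have hi : Integrable fun y => conj (g (-y)) := by
    have h1 : Integrable fun y => g (-y) := hg.comp_neg
    exact (Complex.conjLIE.integrable_comp_iff).2 h1
  have := convolution_eq_zero (K := fun y => conj (g (-y))) hf hi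
    (Complex.continuous_conj.comp (hgc.comp continuous_neg)) (B := B)
    (fun y => by rw [RCLike.norm_conj]; exact hB _)
    (fun θ => (h θ).imp id fun h => by rw [angularFourier_conj_neg, h, map_zero]) 0
  simpa using this

end Convolution

lemma exists_schwartz_norm_le (f : 𝓢(ℝ, ℂ)) (n : ℕ) :
    ∃ A : ℝ, 0 < A ∧ ∀ x, ‖f x‖ ≤ A * ((1 + |x|) ^ n)⁻¹ := by
  set A := 2 ^ n * (Finset.Iic (n, 0)).sup (fun m => SchwartzMap.seminorm ℝ m.1 m.2) f
  have hA : 0 ≤ A := by positivity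
  refine ⟨A + 1, by positivity, fun x => ?_⟩
  have h := SchwartzMap.one_add_le_sup_seminorm_apply (𝕜 := ℝ) (m := (n, 0)) le_rfl le_rfl f x
  rw [norm_iteratedFDeriv_zero, Real.norm_eq_abs] at h
  rw [← div_eq_mul_inv, le_div_iff₀ (by positivity)]
  linarith

/-- Kernels that cut off to the frequencies near `c` at scale `1 / L`: with a plateau of radius
`1 / 2` and a support of radius `7 / 8`, in units of `1 / L`. -/
lemma exists_cutoff_kernel : ∃ C : ℝ, 0 < C ∧ ∀ (c L : ℝ), 0 < L → ∃ K : ℝ → ℂ,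
    Continuous K ∧ Integrable K ∧ (∀ y, ‖K y‖ ≤ C * decayKernel L y) ∧
    (∀ θ, |L * (θ - c)| ≤ 1 / 2 → angularFourier K θ = 1) ∧
    ∀ θ, 7 / 8 ≤ |L * (θ - c)| → angularFourier K θ = 0 := by
  have hpi := Real.pi_pos
  let ψ : ContDiffBump (0 : ℝ) := ⟨1 / 2 / (2 * Real.pi), 7 / 8 / (2 * Real.pi), by positivity,
    by
      apply div_lt_div_of_pos_right _ (by positivity); norm_num⟩
  have hcs : HasCompactSupport fun x => ((ψ x : ℝ) : ℂ) :=
    ψ.hasCompactSupport.comp_left Complex.ofReal_zero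
  let Ψ : 𝓢(ℝ, ℂ) := hcs.toSchwartzMap
    (Complex.ofRealCLM.contDiff.comp ψ.contDiff)
  let Φ : 𝓢(ℝ, ℂ) := 𝓕⁻ Ψ
  have hΦ : ∀ θ, angularFourier Φ θ = (ψ (θ / (2 * Real.pi)) : ℂ) := by
    intro θ
    rw [angularFourier_eq_fourier, ← SchwartzMap.fourier_coe,
      FourierTransform.fourier_fourierInv_eq]
    rfl
  obtain ⟨C, hC, hCΦ⟩ := exists_schwartz_norm_le Φ 2
  refine ⟨C, hC, fun c L hL => ?_⟩
  have hL' : (L : ℂ) ≠ 0 := by exact_mod_cast hL.ne'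
  have hK : ∀ θ, angularFourier
      (fun y : ℝ => Complex.exp (Complex.I * y * c) * ((L : ℂ)⁻¹ * Φ ((y - 0) / L))) θ =
      ψ (L * (θ - c) / (2 * Real.pi)) := by
    intro θ
    have h1 := angularFourier_modulated (fun u => (L : ℂ)⁻¹ * Φ u) 0 c θ hL
    rw [h1]
    have h2 : angularFourier (fun u => (L : ℂ)⁻¹ * Φ u) (L * (θ - c)) =
        (L : ℂ)⁻¹ * angularFourier Φ (L * (θ - c)) := by
      unfold angularFourier
      rw [← integral_const_mul]
      congr 1; ext u; ring
    rw [h2, hΦ]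
    simp [hL']
  have hn : ∀ y : ℝ, ‖Complex.exp (Complex.I * y * c) * ((L : ℂ)⁻¹ * Φ ((y - 0) / L))‖ ≤
      C * decayKernel L y := by
    intro y
    have h1 : Complex.I * y * c = ((y * c : ℝ) : ℂ) * Complex.I := by push_cast; ring
    rw [norm_mul, h1, Complex.norm_exp_ofReal_mul_I, one_mul, norm_mul, norm_inv,
      Complex.norm_of_nonneg hL.le, sub_zero]
    refine (mul_le_mul_of_nonneg_left (hCΦ _) (by positivity)).trans (le_of_eq ?_)
    unfold decayKernel
    rw [abs_div, abs_of_pos hL]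
    have : 0 ≤ |y| := abs_nonneg y
    field_simp
  have hcont : Continuous fun y : ℝ =>
      Complex.exp (Complex.I * y * c) * ((L : ℂ)⁻¹ * Φ ((y - 0) / L)) := by
    have := Φ.continuous
    fun_prop
  refine ⟨_, hcont, ?_, hn, fun θ hθ => ?_, fun θ hθ => ?_⟩
  · exact ((integrable_decayKernel hL).const_mul C).mono' hcont.aestronglyMeasurable
      (Filter.Eventually.of_forall hn)
  · rw [hK, ψ.one_of_mem_closedBall, Complex.ofReal_one]
    rw [Metric.mem_closedBall, dist_zero_right, Real.norm_eq_abs, abs_div,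
      abs_of_pos (by positivity : 0 < 2 * Real.pi)]
    change _ ≤ 1 / 2 / (2 * Real.pi)
    gcongr
  · rw [hK, ψ.zero_of_le_dist, Complex.ofReal_zero]
    rw [dist_zero_right, Real.norm_eq_abs, abs_div,
      abs_of_pos (by positivity : 0 < 2 * Real.pi)]
    change 7 / 8 / (2 * Real.pi) ≤ _
    gcongr

end BandLimited

/-! ### Wave packets -/

lemma bump_eq (ν : ℝ) (I : DyadicInterval) (x : ℝ) :
    bump ν I x = I.length⁻¹ * (I.weight x) ^ (-ν) := by
  have h := I.length_pos
  simp only [bump, translation, dilation, weight, smul_eq_mul]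
  rw [abs_div, abs_of_pos h]
  norm_num [Real.rpow_neg_one]

lemma bump_nonneg (ν : ℝ) (I : DyadicInterval) (x : ℝ) : 0 ≤ bump ν I x := by
  have := I.length_pos
  have := I.weight_pos x
  rw [bump_eq]; positivity

lemma inv_sq_weight (I : DyadicInterval) (x : ℝ) :
    ((I.weight x) ^ 2)⁻¹ = I.length * decayKernel I.length (x - I.center) := by
  have h := I.length_pos
  have h' : 0 ≤ |x - I.center| := abs_nonneg _
  have h2 : 0 < I.length + |x - I.center| := by positivity
  unfold weight decayKernel
  field_simp

lemma packet_apply (φ : ℝ → ℂ) (s : Tile) (x : ℝ) :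
    packet φ s x = Complex.exp (Complex.I * x * s.ω.lower.center) *
      (((√s.I.length)⁻¹ : ℝ) * φ ((x - s.I.center) / s.I.length)) := by
  have h := s.I.length_pos
  simp only [packet, modulation, translation, dilation, Complex.real_smul]
  rw [Real.sqrt_eq_rpow, ← Real.rpow_neg h.le]
  norm_num

lemma norm_packet (φ : ℝ → ℂ) (s : Tile) (x : ℝ) :
    ‖packet φ s x‖ = (√s.I.length)⁻¹ * ‖φ ((x - s.I.center) / s.I.length)‖ := by
  have h1 : Complex.I * x * s.ω.lower.center = ((x * s.ω.lower.center : ℝ) : ℂ) * Complex.I := by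
    push_cast; ring
  rw [packet_apply, norm_mul, h1, Complex.norm_exp_ofReal_mul_I, one_mul, norm_mul,
    Complex.norm_of_nonneg (by positivity)]

lemma exists_norm_packet_le_bump (φ : 𝓢(ℝ, ℂ)) (ν : ℝ) : ∃ A : ℝ, 0 < A ∧ ∀ (s : Tile) (x : ℝ),
    ‖packet φ s x‖ ≤ A * (√s.I.length * bump ν s.I x * ((s.I.weight x) ^ 4)⁻¹) := by
  obtain ⟨n, hn⟩ := exists_nat_ge ν
  obtain ⟨A, hA, hAφ⟩ := exists_schwartz_norm_le φ (n + 4)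
  refine ⟨A, hA, fun s x => ?_⟩
  have hL := s.I.length_pos
  have hw := s.I.weight_pos x
  have hw1 := s.I.one_le_weight x
  have h1 : 1 + |(x - s.I.center) / s.I.length| = s.I.weight x := by
    rw [abs_div, abs_of_pos hL]; rfl
  have h2 := hAφ ((x - s.I.center) / s.I.length)
  rw [h1] at h2
  have h3 : ((s.I.weight x) ^ n)⁻¹ ≤ (s.I.weight x) ^ (-ν) := by
    rw [Real.rpow_neg hw.le]
    apply inv_anti₀ (by positivity)
    rw [← Real.rpow_natCast]
    exact Real.rpow_le_rpow_of_exponent_le hw1 hn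
  have h4 : (√s.I.length)⁻¹ = √s.I.length * s.I.length⁻¹ := by
    have := Real.mul_self_sqrt hL.le
    have h5 : 0 < √s.I.length := Real.sqrt_pos.2 hL
    rw [← div_eq_mul_inv, eq_div_iff hL.ne']
    nth_rewrite 2 [← this]
    field_simp
  rw [norm_packet, bump_eq, h4]
  calc √s.I.length * s.I.length⁻¹ * ‖φ ((x - s.I.center) / s.I.length)‖
      ≤ √s.I.length * s.I.length⁻¹ * (A * ((s.I.weight x) ^ (n + 4))⁻¹) := by gcongr
    _ = A * (√s.I.length * (s.I.length⁻¹ * ((s.I.weight x) ^ n)⁻¹) *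
          ((s.I.weight x) ^ 4)⁻¹) := by rw [pow_add, mul_inv]; ring
    _ ≤ _ := by gcongr

lemma exists_norm_packet_le_kernel (φ : 𝓢(ℝ, ℂ)) : ∃ A : ℝ, 0 < A ∧ ∀ (s : Tile) (x : ℝ),
    ‖packet φ s x‖ ≤ A * (√s.I.length * decayKernel s.I.length (x - s.I.center)) := by
  obtain ⟨A, hA, h⟩ := exists_norm_packet_le_bump φ 0
  refine ⟨A, hA, fun s x => (h s x).trans ?_⟩
  have hL := s.I.length_pos
  have hw1 := s.I.one_le_weight x
  have hw : ((s.I.weight x) ^ 4)⁻¹ ≤ ((s.I.weight x) ^ 2)⁻¹ :=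
    inv_anti₀ (by positivity) (pow_le_pow_right₀ hw1 (by norm_num))
  rw [inv_sq_weight] at hw
  rw [bump_eq, neg_zero, Real.rpow_zero, mul_one]
  calc A * (√s.I.length * s.I.length⁻¹ * ((s.I.weight x) ^ 4)⁻¹)
      ≤ A * (√s.I.length * s.I.length⁻¹ *
          (s.I.length * decayKernel s.I.length (x - s.I.center))) := by gcongr
    _ = _ := by field_simp

lemma continuous_packet (φ : 𝓢(ℝ, ℂ)) (s : Tile) : Continuous (packet φ s) := by
  have : packet φ s = _ := funext (packet_apply φ s)
  rw [this]
  have := φ.continuous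
  fun_prop

lemma integrable_packet (φ : 𝓢(ℝ, ℂ)) (s : Tile) : Integrable (packet φ s) := by
  obtain ⟨A, -, h⟩ := exists_norm_packet_le_kernel φ
  have h1 := ((integrable_decayKernel s.I.length_pos).comp_sub_right s.I.center).const_mul
    (A * √s.I.length)
  refine h1.mono' (continuous_packet φ s).aestronglyMeasurable (Filter.Eventually.of_forall ?_)
  intro x
  rw [mul_assoc]
  exact h s x

lemma exists_bound_packet (φ : 𝓢(ℝ, ℂ)) (s : Tile) : ∃ B, ∀ x, ‖packet φ s x‖ ≤ B := by
  obtain ⟨A, hA, h⟩ := exists_schwartz_norm_le φ 0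
  refine ⟨(√s.I.length)⁻¹ * A, fun x => ?_⟩
  rw [norm_packet]
  gcongr
  simpa using h ((x - s.I.center) / s.I.length)

lemma angularFourier_packet_eq_zero {φ : ℝ → ℂ} {r : ℝ} (hφ : FreqSupportedIn φ r) (s : Tile)
    {θ : ℝ} (hθ : r < |s.I.length * (θ - s.ω.lower.center)|) :
    angularFourier (packet φ s) θ = 0 := by
  have h1 : packet φ s = _ := funext (packet_apply φ s)
  rw [h1, angularFourier_modulated
    (fun u => (((√s.I.length)⁻¹ : ℝ) : ℂ) * φ u) _ _ _ s.I.length_pos]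
  have h2 : angularFourier (fun u => (((√s.I.length)⁻¹ : ℝ) : ℂ) * φ u)
      (s.I.length * (θ - s.ω.lower.center)) = (((√s.I.length)⁻¹ : ℝ) : ℂ) *
        angularFourier φ (s.I.length * (θ - s.ω.lower.center)) := by
    unfold angularFourier
    rw [← integral_const_mul]
    congr 1; ext u; ring
  have h3 : angularFourier φ (s.I.length * (θ - s.ω.lower.center)) = 0 := hφ _ hθ
  rw [h2, h3, mul_zero, mul_zero]

/-- The spectrum of a wave packet lies well inside the lower half of its frequency interval. -/
lemma spectrum_packet {φ : ℝ → ℂ} {r : ℝ} (hφ : FreqSupportedIn φ r) (hr : r ≤ 1 / 16) (s : Tile)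
    {θ : ℝ} (hθ : angularFourier (packet φ s) θ ≠ 0) :
    s.ω.center - s.ω.length * (5 / 16) ≤ θ ∧ θ ≤ s.ω.center - s.ω.length * (3 / 16) := by
  by_contra hcon
  apply hθ
  apply angularFourier_packet_eq_zero hφ
  refine hr.trans_lt ?_
  by_contra hle
  apply hcon
  have hL := s.I.length_pos
  have h1 := abs_le.1 (not_lt.1 hle)
  have h2 : θ - s.ω.lower.center = s.ω.length * (s.I.length * (θ - s.ω.lower.center)) := by
    rw [s.length_ω]; field_simp
  have h3 := s.ω.center_lower
  have h4 := s.ω.length_pos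
  constructor <;> nlinarith [mul_le_mul_of_nonneg_left h1.1 h4.le,
    mul_le_mul_of_nonneg_left h1.2 h4.le]

/-! ### Lacunary families of tiles -/

/-- For tiles `s` whose upper frequency halves `ω_{s+}` share a point `ξ`, the spectra of the wave
packets lie to the left of `ξ`, at a distance comparable to `|ω_s|`; they are disjoint for different
scales, because `ω_{s'}` is contained in `ω_{s+}` if `|I_s| < |I_{s'}|`. -/
lemma spectra_disjoint {φ : ℝ → ℂ} {r : ℝ} (hφ : FreqSupportedIn φ r) (hr : r ≤ 1 / 16)
    {s s' : Tile} {ξ : ℝ} (h : ξ ∈ s.ω.upper.toSet) (h' : ξ ∈ s'.ω.upper.toSet)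
    (hk : s.I.k ≠ s'.I.k) (θ : ℝ) :
    angularFourier (packet φ s) θ = 0 ∨ angularFourier (packet φ s') θ = 0 := by
  wlog hlt : s.I.k < s'.I.k generalizing s s'
  · exact (this h' h hk.symm (by omega)).symm
  by_contra hcon
  push Not at hcon
  have h1 := (spectrum_packet hφ hr s hcon.1).2
  have h2 := (spectrum_packet hφ hr s' hcon.2).1
  have h3 := Tile.ω_subset_upper_of_lt h (upper_subset _ h') hlt s'.ω.left_mem
  rw [mem_upper_iff] at h3
  have h4 := s.ω.length_pos
  have h5 := s'.ω.length_pos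
  have h6 : s'.ω.center = s'.ω.m * s'.ω.length + s'.ω.length / 2 := by
    unfold DyadicInterval.center; ring
  linarith [h3.1]

/-- The superposition of the wave packets of the tiles in `T`, with coefficients `b`. -/
noncomputable def superpose (φ : ℝ → ℂ) (T : Finset Tile) (b : Tile → ℂ) (x : ℝ) : ℂ :=
  ∑ s ∈ T, b s * packet φ s x

lemma continuous_superpose (φ : 𝓢(ℝ, ℂ)) (T : Finset Tile) (b : Tile → ℂ) :
    Continuous (superpose φ T b) :=
  continuous_finsetSum _ fun s _ => continuous_const.mul (continuous_packet φ s)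

lemma integrable_superpose (φ : 𝓢(ℝ, ℂ)) (T : Finset Tile) (b : Tile → ℂ) :
    Integrable (superpose φ T b) :=
  integrable_finsetSum _ fun s _ => (integrable_packet φ s).const_mul _

lemma exists_bound_superpose (φ : 𝓢(ℝ, ℂ)) (T : Finset Tile) (b : Tile → ℂ) :
    ∃ B, ∀ x, ‖superpose φ T b x‖ ≤ B := by
  choose B hB using exists_bound_packet φ
  refine ⟨∑ s ∈ T, ‖b s‖ * B s, fun x => (norm_sum_le _ _).trans (Finset.sum_le_sum fun s _ => ?_)⟩
  rw [norm_mul]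
  gcongr
  exact hB s x

lemma angularFourier_superpose (φ : 𝓢(ℝ, ℂ)) (T : Finset Tile) (b : Tile → ℂ) (θ : ℝ) :
    angularFourier (superpose φ T b) θ = ∑ s ∈ T, b s * angularFourier (packet φ s) θ := by
  unfold angularFourier superpose
  simp_rw [Finset.mul_sum]
  rw [integral_finsetSum]
  · refine Finset.sum_congr rfl fun s _ => ?_
    rw [← integral_const_mul]
    congr 1; ext x; ring
  · intro s _
    refine (((integrable_packet φ s).const_mul (b s)).norm).mono' ?_ ?_
    · have := continuous_packet φ s
      exact Continuous.aestronglyMeasurable (by fun_prop)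
    · refine Filter.Eventually.of_forall fun x => ?_
      have h1 : -(Complex.I * x * θ) = ((-(x * θ) : ℝ) : ℂ) * Complex.I := by push_cast; ring
      rw [norm_mul, h1, Complex.norm_exp_ofReal_mul_I, one_mul]

/-- Pythagoras' theorem for pairwise orthogonal functions. -/
lemma lintegral_enorm_sum_sq {ι : Type*} (S : Finset ι) {g : ι → ℝ → ℂ}
    (hc : ∀ i, Continuous (g i)) (hi : ∀ i, Integrable (g i)) (hb : ∀ i, ∃ B, ∀ x, ‖g i x‖ ≤ B)
    (h : ∀ i ∈ S, ∀ j ∈ S, i ≠ j → ∫ x, g i x * conj (g j x) = 0) :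
    ∫⁻ x, ‖∑ i ∈ S, g i x‖ₑ ^ 2 = ∑ i ∈ S, ∫⁻ x, ‖g i x‖ₑ ^ 2 := by
  have hint : ∀ i j, Integrable fun x => g i x * conj (g j x) := by
    intro i j
    obtain ⟨B, hB⟩ := hb j
    refine (hi i).mul_bdd (c := B) (Complex.continuous_conj.comp (hc j)).aestronglyMeasurable
      (Filter.Eventually.of_forall fun x => ?_)
    rw [RCLike.norm_conj]; exact hB x
  have hself : ∀ f : ℝ → ℂ, (fun x => f x * conj (f x)) = fun x => ((‖f x‖ ^ 2 : ℝ) : ℂ) :=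
    fun f => funext fun x => by rw [Complex.mul_conj']; push_cast; rfl
  have hre : ∀ f : ℝ → ℂ, (∫ x, f x * conj (f x)).re = ∫ x, ‖f x‖ ^ 2 := fun f => by
    rw [hself, integral_complex_ofReal, Complex.ofReal_re]
  have key : ∀ f : ℝ → ℂ, (Integrable fun x => f x * conj (f x)) →
      ∫⁻ x, ‖f x‖ₑ ^ 2 = ENNReal.ofReal (∫ x, f x * conj (f x)).re := by
    intro f hf
    have h2 : Integrable fun x => ‖f x‖ ^ 2 := by
      have := hf.norm
      simpa [sq] using this
    rw [hre, ofReal_integral_eq_lintegral_ofReal h2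
      (Filter.Eventually.of_forall fun x => by positivity)]
    refine lintegral_congr fun x => ?_
    rw [ENNReal.ofReal_pow (norm_nonneg _), ofReal_norm]
  have hexp : ∀ x, (∑ i ∈ S, g i x) * conj (∑ i ∈ S, g i x) =
      ∑ i ∈ S, ∑ j ∈ S, g i x * conj (g j x) := fun x => by
    rw [map_sum, Finset.sum_mul_sum]
  rw [key (fun x => ∑ i ∈ S, g i x) (by
    simp_rw [hexp]
    exact integrable_finsetSum _ fun i _ => integrable_finsetSum _ fun j _ => hint i j)]
  simp_rw [hexp]
  rw [integral_finsetSum _ fun i _ => integrable_finsetSum _ fun j _ => hint i j]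
  have h3 : ∀ i ∈ S, ∫ x, ∑ j ∈ S, g i x * conj (g j x) = ∫ x, g i x * conj (g i x) := by
    intro i hiS
    rw [integral_finsetSum _ fun j _ => hint i j]
    exact Finset.sum_eq_single_of_mem i hiS fun j hj hji => h i hiS j hj hji.symm
  rw [Finset.sum_congr rfl h3, Complex.re_sum, ENNReal.ofReal_sum_of_nonneg]
  · exact Finset.sum_congr rfl fun i _ => (key (g i) (hint i i)).symm
  · intro i _
    rw [hre]
    positivity

/-- Almost orthogonality at a single scale, from the spatial decay. -/
lemma exists_superpose_single_scale_le (φ : 𝓢(ℝ, ℂ)) : ∃ C : ℝ≥0∞, C ≠ ⊤ ∧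
    ∀ (T : Finset Tile) (ξ : ℝ) (k : ℤ), (∀ s ∈ T, ξ ∈ s.ω.toSet) → (∀ s ∈ T, s.I.k = k) →
      ∀ b : Tile → ℂ, ∫⁻ x, ‖superpose φ T b x‖ₑ ^ 2 ≤ C * ∑ s ∈ T, ‖b s‖ₑ ^ 2 := by
  obtain ⟨A, hA, hφ⟩ := exists_norm_packet_le_kernel φ
  obtain ⟨D, hD, hsum⟩ := exists_sum_weight_le
  refine ⟨ENNReal.ofReal (A ^ 2 * D) * kernelMass, by have := kernelMass_ne_top; finiteness,
    fun T ξ k hξ hk b => ?_⟩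
  have hpt : ∀ x, ‖superpose φ T b x‖ₑ ^ 2 ≤ ∑ s ∈ T, ENNReal.ofReal (A ^ 2 * D) *
      (‖b s‖ₑ ^ 2 * ENNReal.ofReal (decayKernel s.I.length (x - s.I.center))) := by
    intro x
    have hd : ∀ s : Tile, 0 ≤ decayKernel s.I.length (x - s.I.center) :=
      fun s => decayKernel_nonneg s.I.length_pos _
    have h1 : ‖superpose φ T b x‖ ^ 2 ≤ ∑ s ∈ T, A ^ 2 * D *
        (‖b s‖ ^ 2 * decayKernel s.I.length (x - s.I.center)) := by
      set q : Tile → ℝ := fun s => s.I.length * decayKernel s.I.length (x - s.I.center)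
      have hq : ∀ s, 0 ≤ q s := fun s => mul_nonneg s.I.length_pos.le (hd s)
      have h2 : ‖superpose φ T b x‖ ≤
          ∑ s ∈ T, (A * ‖b s‖ * √(decayKernel s.I.length (x - s.I.center))) * √(q s) := by
        refine (norm_sum_le _ _).trans (Finset.sum_le_sum fun s _ => ?_)
        rw [norm_mul]
        calc ‖b s‖ * ‖packet φ s x‖
            ≤ ‖b s‖ * (A * (√s.I.length * decayKernel s.I.length (x - s.I.center))) := by
              gcongr; exact hφ s x
          _ = _ := by
              have := Real.mul_self_sqrt (hd s)
              simp only [q]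
              rw [Real.sqrt_mul s.I.length_pos.le]
              nth_rewrite 1 [← this]
              ring
      have h3 : ∑ s ∈ T, q s ≤ D := by
        have := hsum T ξ k hξ hk x
        simpa only [inv_sq_weight] using this
      calc ‖superpose φ T b x‖ ^ 2
          ≤ (∑ s ∈ T, (A * ‖b s‖ * √(decayKernel s.I.length (x - s.I.center))) * √(q s)) ^ 2 := by
            gcongr
        _ ≤ (∑ s ∈ T, (A * ‖b s‖ * √(decayKernel s.I.length (x - s.I.center))) ^ 2) *
              ∑ s ∈ T, √(q s) ^ 2 := Finset.sum_mul_sq_le_sq_mul_sq _ _ _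
        _ = (∑ s ∈ T, A ^ 2 * (‖b s‖ ^ 2 * decayKernel s.I.length (x - s.I.center))) *
              ∑ s ∈ T, q s := by
            congr 1
            · refine Finset.sum_congr rfl fun s _ => ?_
              rw [mul_pow, mul_pow, Real.sq_sqrt (hd s), mul_assoc]
            · exact Finset.sum_congr rfl fun s _ => Real.sq_sqrt (hq s)
        _ ≤ (∑ s ∈ T, A ^ 2 * (‖b s‖ ^ 2 * decayKernel s.I.length (x - s.I.center))) * D := by
            refine mul_le_mul_of_nonneg_left h3 (Finset.sum_nonneg fun s _ => ?_)
            have := hd s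
            positivity
        _ = _ := by
            rw [Finset.sum_mul]
            exact Finset.sum_congr rfl fun s _ => by ring
    rw [← ofReal_norm, ← ENNReal.ofReal_pow (norm_nonneg _)]
    refine (ENNReal.ofReal_le_ofReal h1).trans ?_
    rw [ENNReal.ofReal_sum_of_nonneg fun s _ => by have := hd s; positivity]
    refine le_of_eq (Finset.sum_congr rfl fun s _ => ?_)
    rw [ENNReal.ofReal_mul (p := A ^ 2 * D) (by positivity),
      ENNReal.ofReal_mul (p := ‖b s‖ ^ 2) (by positivity), ENNReal.ofReal_pow (norm_nonneg _),
      ofReal_norm]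
  calc ∫⁻ x, ‖superpose φ T b x‖ₑ ^ 2
      ≤ ∫⁻ x, ∑ s ∈ T, ENNReal.ofReal (A ^ 2 * D) *
        (‖b s‖ₑ ^ 2 * ENNReal.ofReal (decayKernel s.I.length (x - s.I.center))) :=
        lintegral_mono hpt
    _ = ∑ s ∈ T, ENNReal.ofReal (A ^ 2 * D) * (‖b s‖ₑ ^ 2 * kernelMass) := by
        rw [lintegral_finsetSum _ fun s _ => by fun_prop]
        refine Finset.sum_congr rfl fun s _ => ?_
        rw [lintegral_const_mul _ (by fun_prop), lintegral_const_mul _ (by fun_prop),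
          lintegral_decayKernel s.I.length_pos]
    _ = _ := by
        rw [Finset.mul_sum]
        exact Finset.sum_congr rfl fun s _ => by ring

/-- The `L²` bound for superpositions over lacunary families: different scales are exactly
orthogonal. -/
lemma exists_superpose_le (φ : 𝓢(ℝ, ℂ)) {r : ℝ} (hφ : FreqSupportedIn φ r) (hr : r ≤ 1 / 16) :
    ∃ C : ℝ≥0∞, C ≠ ⊤ ∧ ∀ (T : Finset Tile) (ξ : ℝ), (∀ s ∈ T, ξ ∈ s.ω.upper.toSet) →
      ∀ b : Tile → ℂ, ∫⁻ x, ‖superpose φ T b x‖ₑ ^ 2 ≤ C * ∑ s ∈ T, ‖b s‖ₑ ^ 2 := by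
  obtain ⟨C, hC, hscale⟩ := exists_superpose_single_scale_le φ
  refine ⟨C, hC, fun T ξ hξ b => ?_⟩
  classical
  set S := T.image fun s => s.I.k
  have hmaps : ∀ s ∈ T, s.I.k ∈ S := fun s hs => Finset.mem_image_of_mem _ hs
  set g : ℤ → ℝ → ℂ := fun k => superpose φ (T.filter fun s => s.I.k = k) b
  have hg : ∀ x, superpose φ T b x = ∑ k ∈ S, g k x := fun x =>
    (Finset.sum_fiberwise_of_maps_to hmaps fun s => b s * packet φ s x).symm
  simp_rw [hg]
  rw [lintegral_enorm_sum_sq S (fun k => continuous_superpose _ _ _)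
    (fun k => integrable_superpose _ _ _) (fun k => exists_bound_superpose _ _ _)]
  · rw [← Finset.sum_fiberwise_of_maps_to hmaps, Finset.mul_sum]
    refine Finset.sum_le_sum fun k _ => hscale _ ξ k ?_ ?_ b
    · intro s hs
      exact upper_subset _ (hξ s (Finset.mem_filter.1 hs).1)
    · intro s hs
      exact (Finset.mem_filter.1 hs).2
  · intro k _ k' _ hkk'
    obtain ⟨B, hB⟩ := exists_bound_superpose φ (T.filter fun s => s.I.k = k') b
    refine integral_mul_conj_eq_zero (integrable_superpose _ _ _) (integrable_superpose _ _ _)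
      (continuous_superpose _ _ _) hB fun θ => ?_
    by_contra hcon
    push Not at hcon
    simp only [angularFourier_superpose] at hcon
    obtain ⟨s, hs, hs0⟩ := Finset.exists_ne_zero_of_sum_ne_zero hcon.1
    obtain ⟨s', hs', hs0'⟩ := Finset.exists_ne_zero_of_sum_ne_zero hcon.2
    rw [Finset.mem_filter] at hs hs'
    rcases spectra_disjoint hφ hr (hξ s hs.1) (hξ s' hs'.1)
      (by rw [hs.2, hs'.2]; exact hkk') θ with h | h
    · exact hs0 (by rw [h, mul_zero])
    · exact hs0' (by rw [h, mul_zero])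

/-- In a lacunary family, the part at scales at least `2 ^ a` is the image of the whole under
convolution with a kernel that lives at scale `2 ^ a`: the plateau of its Fourier transform is the
dyadic interval of length `2 ^ (-a)` that contains the common frequency `ξ`. The spectra at scales
at least `2 ^ a` lie in this interval, and those at smaller scales stay away from it by
`7 / 8 * 2 ^ (-a)`, measured from its center. -/
lemma exists_truncate_le {r : ℝ} (hr : r ≤ 1 / 16) : ∃ C : ℝ≥0∞, C ≠ ⊤ ∧
    ∀ (φ : 𝓢(ℝ, ℂ)), FreqSupportedIn φ r →
    ∀ (T : Finset Tile) (ξ : ℝ), (∀ s ∈ T, ξ ∈ s.ω.upper.toSet) →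
      ∀ (b : Tile → ℂ) (a : ℤ) (x : ℝ), ‖superpose φ (T.filter fun s => a ≤ s.I.k) b x‖ₑ ≤
        C * kernelAvg (2 ^ a) (fun y => ‖superpose φ T b y‖ₑ) x := by
  obtain ⟨C, hC, hker⟩ := exists_cutoff_kernel
  refine ⟨ENNReal.ofReal C, by finiteness, fun φ hφ T ξ hξ b a x => ?_⟩
  have ha : (0 : ℝ) < 2 ^ a := by positivity
  set Ω := around (-a) ξ with hΩ
  have hΩl : Ω.length = (2 ^ a)⁻¹ := by rw [hΩ, length_around, zpow_neg]
  obtain ⟨K, hKc, hKi, hKb, hK1, hK0⟩ := hker Ω.center (2 ^ a) ha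
  have hKB : ∀ y, ‖K y‖ ≤ C * (2 ^ a)⁻¹ := fun y => by
    refine (hKb y).trans ?_
    gcongr
    unfold decayKernel
    have : 0 ≤ |y| := abs_nonneg y
    rw [inv_eq_one_div, div_le_div_iff₀ (by positivity) ha]
    nlinarith
  have hpack : ∀ s ∈ T, ∫ y, packet φ s y * K (x - y) =
      if a ≤ s.I.k then packet φ s x else 0 := by
    intro s hs
    have hωpos := s.ω.length_pos
    split_ifs with hak
    · refine convolution_eq_self (integrable_packet φ s) (continuous_packet φ s) hKi hKc hKB
        (fun θ => ?_) x
      by_contra hcon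
      push Not at hcon
      apply hcon.2
      apply hK1
      have hθ := spectrum_packet hφ hr s hcon.1
      have hmem : θ ∈ s.ω.toSet := by
        have hc : s.ω.center = s.ω.m * s.ω.length + s.ω.length / 2 := by
          unfold DyadicInterval.center; ring
        constructor <;> nlinarith [hθ.1, hθ.2]
      have hsub : s.ω.toSet ⊆ Ω.toSet := by
        rw [Tile.ω_eq_around (upper_subset _ (hξ s hs))]
        exact around_subset_around (by omega) ξ
      have h1 := abs_sub_center_le (hsub hmem)
      rw [hΩl] at h1
      rw [abs_mul, abs_of_pos ha]
      calc (2 : ℝ) ^ a * |θ - Ω.center| ≤ 2 ^ a * ((2 ^ a)⁻¹ / 2) := by gcongr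
        _ = 1 / 2 := by field_simp
    · refine convolution_eq_zero (integrable_packet φ s) hKi hKc hKB (fun θ => ?_) x
      by_contra hcon
      push Not at hcon
      apply hcon.2
      apply hK0
      have hθ := (spectrum_packet hφ hr s hcon.1).2
      have hsub : Ω.toSet ⊆ s.ω.upper.toSet := by
        rw [Tile.upper_eq_around (hξ s hs)]
        exact around_subset_around (by omega) ξ
      have h1 := (mem_upper_iff.1 (hsub Ω.left_mem)).1
      have h2 : Ω.center = Ω.m * Ω.length + Ω.length / 2 := by
        unfold DyadicInterval.center; ring
      have h3 : 2 * (2 ^ a : ℝ)⁻¹ ≤ s.ω.length := by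
        unfold DyadicInterval.length
        rw [s.ω_k, ← zpow_neg, ← zpow_one_add₀ two_ne_zero]
        exact zpow_le_zpow_right₀ (by norm_num) (by omega)
      have h4 : (2 ^ a : ℝ)⁻¹ * (7 / 8) ≤ Ω.center - θ := by
        rw [hΩl] at h1 h2
        linarith
      rw [abs_mul, abs_of_pos ha, abs_sub_comm]
      calc (7 / 8 : ℝ) = 2 ^ a * ((2 ^ a : ℝ)⁻¹ * (7 / 8)) := by field_simp
        _ ≤ 2 ^ a * |Ω.center - θ| := by gcongr; exact h4.trans (le_abs_self _)
  have hconv : superpose φ (T.filter fun s => a ≤ s.I.k) b x =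
      ∫ y, superpose φ T b y * K (x - y) := by
    unfold superpose
    simp_rw [Finset.sum_mul]
    rw [integral_finsetSum, Finset.sum_filter]
    · refine Finset.sum_congr rfl fun s hs => ?_
      simp_rw [mul_assoc]
      rw [integral_const_mul, hpack s hs, mul_ite, mul_zero]
    · intro s _
      refine ((integrable_packet φ s).const_mul (b s)).mul_bdd (c := C * (2 ^ a)⁻¹)
        (hKc.comp (continuous_const.sub continuous_id)).aestronglyMeasurable
        (Filter.Eventually.of_forall fun y => hKB _)
  rw [hconv]
  refine (enorm_integral_le_lintegral_enorm _).trans ?_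
  unfold kernelAvg
  rw [← lintegral_const_mul' _ _ ENNReal.ofReal_ne_top]
  refine lintegral_mono fun y => ?_
  dsimp only
  rw [enorm_mul, mul_comm, ← mul_assoc]
  gcongr
  rw [← ofReal_norm, ← ENNReal.ofReal_mul hC.le]
  exact ENNReal.ofReal_le_ofReal (hKb _)

/-- Any block of scales of a lacunary family is controlled by the maximal averages of the whole, at
all points within the smallest scale of the block. -/
lemma exists_block_le {r : ℝ} (hr : r ≤ 1 / 16) : ∃ C : ℝ≥0∞, C ≠ ⊤ ∧
    ∀ (φ : 𝓢(ℝ, ℂ)), FreqSupportedIn φ r →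
    ∀ (T : Finset Tile) (ξ : ℝ), (∀ s ∈ T, ξ ∈ s.ω.upper.toSet) →
    ∀ (S : Finset ℤ), (∀ s ∈ T, s.I.k ∈ S ∧ s.I.k + 1 ∈ S) →
    ∀ (P : Set ℤ) [DecidablePred fun s : Tile => s.I.k ∈ P], P.OrdConnected →
    ∀ (b : Tile → ℂ) (x z : ℝ), (∀ k ∈ P, |x - z| ≤ 2 ^ k) →
      ‖superpose φ (T.filter fun s => s.I.k ∈ P) b x‖ₑ ≤
        C * ⨆ a ∈ S, kernelAvg (2 ^ a) (fun y => ‖superpose φ T b y‖ₑ) z := by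
  obtain ⟨C, hC, htr⟩ := exists_truncate_le hr
  refine ⟨8 * C, by finiteness, fun φ hφ T ξ hξ S hS P _ hP b x z hxz => ?_⟩
  set M := ⨆ a ∈ S, kernelAvg (2 ^ a) (fun y => ‖superpose φ T b y‖ₑ) z with hM
  rcases (T.filter fun s => s.I.k ∈ P).eq_empty_or_nonempty with h0 | hne
  · rw [h0]; simp [superpose]
  have hone : ∀ a ∈ S, |x - z| ≤ 2 ^ a →
      ‖superpose φ (T.filter fun s => a ≤ s.I.k) b x‖ₑ ≤ 4 * C * M := by
    intro a haS hxa
    refine (htr φ hφ T ξ hξ b a x).trans ?_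
    have h1 : kernelAvg (2 ^ a) (fun y => ‖superpose φ T b y‖ₑ) x ≤
        4 * kernelAvg (2 ^ a) (fun y => ‖superpose φ T b y‖ₑ) z := by
      unfold kernelAvg
      rw [← lintegral_const_mul' _ _ (by finiteness)]
      refine lintegral_mono fun y => ?_
      dsimp only
      rw [← mul_assoc]
      gcongr
      rw [← ENNReal.ofReal_ofNat 4, ← ENNReal.ofReal_mul (by norm_num)]
      refine ENNReal.ofReal_le_ofReal (decayKernel_le_of_near (by positivity) ?_)
      simpa using hxa
    have h2 : kernelAvg (2 ^ a) (fun y => ‖superpose φ T b y‖ₑ) z ≤ M := by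
      rw [hM]
      exact le_iSup₂ (f := fun (a : ℤ) (_ : a ∈ S) =>
        kernelAvg (2 ^ a) (fun y => ‖superpose φ T b y‖ₑ) z) a haS
    calc C * kernelAvg (2 ^ a) (fun y => ‖superpose φ T b y‖ₑ) x ≤ C * (4 * M) := by
          gcongr; exact h1.trans (by gcongr)
      _ = _ := by ring
  obtain ⟨s₀, hs₀, hmin⟩ := Finset.exists_min_image _ (fun s : Tile => s.I.k) hne
  obtain ⟨s₁, hs₁, hmax⟩ := Finset.exists_max_image _ (fun s : Tile => s.I.k) hne
  rw [Finset.mem_filter] at hs₀ hs₁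
  have hsplit : superpose φ (T.filter fun s => s.I.k ∈ P) b x =
      superpose φ (T.filter fun s => s₀.I.k ≤ s.I.k) b x -
        superpose φ (T.filter fun s => s₁.I.k + 1 ≤ s.I.k) b x := by
    unfold superpose
    rw [eq_sub_iff_add_eq, Finset.sum_filter, Finset.sum_filter, Finset.sum_filter,
      ← Finset.sum_add_distrib]
    refine Finset.sum_congr rfl fun s hs => ?_
    by_cases hsP : s.I.k ∈ P
    · have h1 := hmin s (Finset.mem_filter.2 ⟨hs, hsP⟩)
      have h2 := hmax s (Finset.mem_filter.2 ⟨hs, hsP⟩)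
      rw [if_pos hsP, if_neg (by omega), if_pos h1, add_zero]
    · have h1 : ¬ (s₀.I.k ≤ s.I.k ∧ s.I.k ≤ s₁.I.k) := fun h =>
        hsP (hP.out hs₀.2 hs₁.2 h)
      have h2 : s₀.I.k ≤ s₁.I.k := hmin s₁ (Finset.mem_filter.2 hs₁)
      rw [if_neg hsP, zero_add]
      congr 1
      apply propext
      omega
  have h0 := hxz _ hs₀.2
  have h1 := hxz _ hs₁.2
  rw [hsplit]
  calc _ ≤ 4 * C * M + 4 * C * M := by
        refine (enorm_sub_le).trans (add_le_add ?_ ?_)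
        · exact hone _ (hS s₀ hs₀.1).1 h0
        · refine hone _ (hS s₁ hs₁.1).2 (h1.trans ?_)
          exact zpow_le_zpow_right₀ (by norm_num) (by omega)
    _ = _ := by ring

/-! ### The distance function of a tree -/

/-- The distance from `x` to the spatial intervals of the tiles in `T`, where a point near `I_s`
still counts as being at distance `|I_s|`. It plays the role of the length of the Whitney interval
of `T` that contains `x`. -/
noncomputable def treeDist (T : Finset Tile) (hT : T.Nonempty) (x : ℝ) : ℝ :=
  T.inf' hT fun s => s.I.length + |x - s.I.center|

section treeDist

variable {T : Finset Tile} {hT : T.Nonempty}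

lemma treeDist_pos (x : ℝ) : 0 < treeDist T hT x :=
  (Finset.lt_inf'_iff hT).2 fun s _ => by have := s.I.length_pos; positivity

lemma treeDist_le {s : Tile} (hs : s ∈ T) (x : ℝ) :
    treeDist T hT x ≤ s.I.length + |x - s.I.center| :=
  Finset.inf'_le _ hs

lemma exists_treeDist_eq (x : ℝ) :
    ∃ s ∈ T, treeDist T hT x = s.I.length + |x - s.I.center| :=
  Finset.exists_mem_eq_inf' hT _

lemma treeDist_le_add (x z : ℝ) : treeDist T hT x ≤ treeDist T hT z + |x - z| := by
  obtain ⟨s, hs, h⟩ := exists_treeDist_eq (T := T) (hT := hT) z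
  rw [h]
  have := abs_sub_le x z s.I.center
  linarith [treeDist_le (hT := hT) hs x]

lemma continuous_treeDist : Continuous (treeDist T hT) := by
  have : LipschitzWith 1 (treeDist T hT) := by
    refine LipschitzWith.of_le_add fun x z => ?_
    rw [Real.dist_eq]
    exact treeDist_le_add x z
  exact this.continuous

@[fun_prop]
lemma measurable_treeDist : Measurable (treeDist T hT) := continuous_treeDist.measurable

/-- Averaging over the ball around `x` of radius a quarter of `treeDist x`. -/
lemma le_lintegral_of_le_near {x : ℝ} {c : ℝ≥0∞} {g : ℝ → ℝ≥0∞}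
    (h : ∀ z, |x - z| ≤ treeDist T hT x / 4 → c ≤ g z) :
    c ≤ 3 * ∫⁻ z, ENNReal.ofReal (treeDist T hT z)⁻¹ * g z := by
  set R := treeDist T hT x with hR
  have hR0 : 0 < R := treeDist_pos x
  have h1 : ∀ z ∈ Metric.closedBall x (R / 4),
      ENNReal.ofReal (4 / (5 * R)) * c ≤ ENNReal.ofReal (treeDist T hT z)⁻¹ * g z := by
    intro z hz
    rw [Metric.mem_closedBall, Real.dist_eq] at hz
    gcongr
    · have h2 := treeDist_le_add (T := T) (hT := hT) z x
      have h3 := treeDist_pos (T := T) (hT := hT) z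
      rw [← hR] at h2
      rw [inv_eq_one_div, div_le_div_iff₀ (by positivity) h3]
      linarith
    · exact h z (by rwa [abs_sub_comm])
  calc c ≤ 3 * (ENNReal.ofReal (4 / (5 * R)) * c * ENNReal.ofReal (2 * (R / 4))) := by
        have h2 : (1 : ℝ≥0∞) ≤ ENNReal.ofReal (3 * (4 / (5 * R) * (2 * (R / 4)))) := by
          rw [ENNReal.one_le_ofReal]
          field_simp
          norm_num
        rw [ENNReal.ofReal_mul (by norm_num), ENNReal.ofReal_mul (by positivity),
          ENNReal.ofReal_ofNat] at h2
        calc c = 1 * c := (one_mul c).symm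
          _ ≤ _ := mul_le_mul_left h2 c
          _ = _ := by ring
    _ = 3 * ∫⁻ _ in Metric.closedBall x (R / 4), ENNReal.ofReal (4 / (5 * R)) * c := by
        rw [setLIntegral_const, Real.volume_closedBall]
    _ ≤ 3 * ∫⁻ z in Metric.closedBall x (R / 4), ENNReal.ofReal (treeDist T hT z)⁻¹ * g z := by
        gcongr 3 * ?_
        exact setLIntegral_mono' measurableSet_closedBall h1
    _ ≤ _ := by gcongr 3 * ?_; exact setLIntegral_le_lintegral _ _

end treeDist

lemma Tile.Below.refl (s : Tile) : s.Below s := ⟨subset_rfl, subset_rfl⟩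

lemma lintegral_bump_le_density (ν : ℝ) (N : ℝ → ℝ) (H : Set ℝ) {S : Set Tile} {s s' : Tile}
    (hs : s ∈ S) (h : s.Below s') :
    ∫⁻ x in N ⁻¹' s'.ω.toSet ∩ H, ENNReal.ofReal (bump ν s'.I x) ≤ density ν N H S :=
  (le_iSup₂ (f := fun (s' : Tile) (_ : s.Below s') =>
    ∫⁻ x in N ⁻¹' s'.ω.toSet ∩ H, ENNReal.ofReal (bump ν s'.I x)) s' h).trans
    (le_iSup₂ (f := fun (s : Tile) (_ : s ∈ S) => tileDensity ν N H s) s hs)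

/-- The lower left corner of the frequency interval of the top lies in the frequency interval of
every tile of a tree. -/
lemma IsTree.left_mem {T : Set Tile} {t : Tile} (h : IsTree T t) {s : Tile} (hs : s ∈ T) :
    t.ω.m * t.ω.length ∈ s.ω.toSet := (h s hs).1 t.ω.left_mem

/-! ### The contribution of the points far from a tile -/

/-- Sum over the tiles of a tree that are small compared to `R`, of their weights at `z`. -/
lemma exists_sum_length_mul_weight_le : ∃ D : ℝ, 0 < D ∧ ∀ (T : Finset Tile) (t : Tile),
    IsTree T t → ∀ (R : ℝ), 0 < R → (∀ s ∈ T, s.I.length ≤ R) → ∀ z,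
      ∑ s ∈ T, s.I.length * ((s.I.weight z) ^ 4)⁻¹ ≤ D * R * ((t.I.weight z) ^ 2)⁻¹ := by
  obtain ⟨D, hD, hsum⟩ := exists_sum_weight_le
  refine ⟨8 * D, by positivity, fun T t hT R hR hTR z => ?_⟩
  classical
  set S := T.image fun s => s.I.k
  have hmaps : ∀ s ∈ T, s.I.k ∈ S := fun s hs => Finset.mem_image_of_mem _ hs
  have hwt := t.I.weight_pos z
  have hone : ∀ s ∈ T, s.I.length * ((s.I.weight z) ^ 4)⁻¹ ≤
      4 * ((t.I.weight z) ^ 2)⁻¹ * (s.I.length * ((s.I.weight z) ^ 2)⁻¹) := by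
    intro s hs
    have h1 := weight_le_two_mul_weight (hT s hs).2 (hT s hs).length_le z
    have hL := s.I.length_pos
    have hw := s.I.weight_pos z
    have h2 : ((s.I.weight z) ^ 2)⁻¹ ≤ 4 * ((t.I.weight z) ^ 2)⁻¹ := by
      rw [inv_eq_one_div, ← div_eq_mul_inv, div_le_div_iff₀ (by positivity) (by positivity)]
      nlinarith
    calc s.I.length * ((s.I.weight z) ^ 4)⁻¹
        = ((s.I.weight z) ^ 2)⁻¹ * (s.I.length * ((s.I.weight z) ^ 2)⁻¹) := by
          field_simp
      _ ≤ _ := by gcongr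
  calc ∑ s ∈ T, s.I.length * ((s.I.weight z) ^ 4)⁻¹
      ≤ ∑ s ∈ T, 4 * ((t.I.weight z) ^ 2)⁻¹ * (s.I.length * ((s.I.weight z) ^ 2)⁻¹) :=
        Finset.sum_le_sum hone
    _ = 4 * ((t.I.weight z) ^ 2)⁻¹ * ∑ k ∈ S, ∑ s ∈ T with s.I.k = k,
          s.I.length * ((s.I.weight z) ^ 2)⁻¹ := by
        rw [Finset.sum_fiberwise_of_maps_to hmaps, Finset.mul_sum]
    _ ≤ 4 * ((t.I.weight z) ^ 2)⁻¹ * ∑ k ∈ S, (2 : ℝ) ^ k * D := by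
        gcongr with k hk
        have h1 : ∀ s ∈ T.filter fun s => s.I.k = k, s.I.length * ((s.I.weight z) ^ 2)⁻¹ =
            2 ^ k * ((s.I.weight z) ^ 2)⁻¹ := by
          intro s hs
          rw [← (Finset.mem_filter.1 hs).2]; rfl
        rw [Finset.sum_congr rfl h1, ← Finset.mul_sum]
        gcongr
        refine hsum _ (t.ω.m * t.ω.length) k (fun s hs => ?_)
          (fun s hs => (Finset.mem_filter.1 hs).2) z
        exact hT.left_mem (Finset.mem_coe.2 (Finset.mem_filter.1 hs).1)
    _ ≤ 4 * ((t.I.weight z) ^ 2)⁻¹ * (2 * R * D) := by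
        rw [← Finset.sum_mul]
        gcongr
        refine sum_two_zpow_le S R hR.le fun k hk => ?_
        obtain ⟨s, hs, rfl⟩ := Finset.mem_image.1 hk
        exact hTR s hs
    _ = _ := by ring

/-- The part of the tree sum where `x` is far from `I_s` in the sense of `treeDist`. The decay of
the wave packets, beyond what the density absorbs, is averaged over the ball around `x` with
radius `treeDist x / 4`; only tiles with `|I_s| ≤ 4 treeDist z` contribute at a point `z` there. -/
lemma exists_far_le (φ : 𝓢(ℝ, ℂ)) (ν : ℝ) : ∃ C : ℝ≥0∞, C ≠ ⊤ ∧
    ∀ (T : Finset Tile) (hT : T.Nonempty) (t : Tile), IsTree T t →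
    ∀ (N : ℝ → ℝ), Measurable N → ∀ (H : Set ℝ), MeasurableSet H →
      ∑ s ∈ T, ENNReal.ofReal √s.I.length *
        ∫⁻ x in {x | (N x ∈ s.ω.toSet ∧ x ∈ H) ∧ s.I.length ≤ 2 * treeDist T hT x},
          ‖packet φ s x‖ₑ ≤ C * density ν N H T * ENNReal.ofReal t.I.length := by
  obtain ⟨A, hA, hφ⟩ := exists_norm_packet_le_bump φ ν
  obtain ⟨D, hD, hsum⟩ := exists_sum_length_mul_weight_le
  refine ⟨ENNReal.ofReal A * 3 * ENNReal.ofReal (3 * D * 4) * kernelMass,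
    by have := kernelMass_ne_top; finiteness, fun T hT t hTt N hN H hH => ?_⟩
  classical
  set V : Tile → ℝ → ℝ≥0∞ := fun s z => if s.I.length ≤ 4 * treeDist T hT z then
    ENNReal.ofReal (3 * ((s.I.weight z) ^ 4)⁻¹) else 0 with hV
  have hVm : ∀ s, Measurable (V s) := fun s => by
    refine Measurable.ite (measurableSet_le measurable_const (by fun_prop)) ?_ measurable_const
    have := s.I.continuous_weight.measurable
    fun_prop
  set W : Tile → ℝ≥0∞ := fun s => ∫⁻ z, ENNReal.ofReal (treeDist T hT z)⁻¹ * V s z with hW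
  have hweight : ∀ s ∈ T, ∀ x, s.I.length ≤ 2 * treeDist T hT x →
      ENNReal.ofReal ((s.I.weight x) ^ 4)⁻¹ ≤ 3 * W s := by
    intro s hs x hx
    refine le_lintegral_of_le_near (x := x) fun z hz => ?_
    have h1 := treeDist_le_add (T := T) (hT := hT) x z
    have h2 := treeDist_pos (T := T) (hT := hT) x
    rw [hV]
    dsimp only
    rw [if_pos (by linarith)]
    apply ENNReal.ofReal_le_ofReal
    have hL := s.I.length_pos
    have hwx := s.I.weight_pos x
    have hwz := s.I.weight_pos z
    have h3 : s.I.weight z ≤ 5 / 4 * s.I.weight x := by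
      rw [← mul_le_mul_iff_right₀ hL, length_mul_weight, mul_left_comm, length_mul_weight]
      have h4 := treeDist_le (hT := hT) hs x
      have h5 := abs_sub_le z x s.I.center
      rw [abs_sub_comm z x] at h5
      linarith
    rw [inv_eq_one_div, ← div_eq_mul_inv, div_le_div_iff₀ (by positivity) (by positivity), one_mul]
    calc (s.I.weight z) ^ 4 ≤ (5 / 4 * s.I.weight x) ^ 4 := by gcongr
      _ = (5 / 4) ^ 4 * (s.I.weight x) ^ 4 := by ring
      _ ≤ _ := by gcongr; norm_num
  have hWsum : ∑ s ∈ T, ENNReal.ofReal s.I.length * W s ≤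
      ENNReal.ofReal (3 * D * 4) * (ENNReal.ofReal t.I.length * kernelMass) := by
    have hpt : ∀ z, ∑ s ∈ T, ENNReal.ofReal s.I.length *
        (ENNReal.ofReal (treeDist T hT z)⁻¹ * V s z) ≤
        ENNReal.ofReal (3 * D * 4) * (ENNReal.ofReal t.I.length *
          ENNReal.ofReal (decayKernel t.I.length (z - t.I.center))) := by
      intro z
      have hρ := treeDist_pos (T := T) (hT := hT) z
      have h1 := hsum (T.filter fun s => s.I.length ≤ 4 * treeDist T hT z) t
        (fun s hs => hTt s (Finset.mem_coe.2 (Finset.mem_filter.1 (Finset.mem_coe.1 hs)).1))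
        (4 * treeDist T hT z) (by positivity) (fun s hs => (Finset.mem_filter.1 hs).2) z
      have h2 : ∀ s : Tile, 0 ≤ s.I.length * ((s.I.weight z) ^ 4)⁻¹ := fun s => by
        have := s.I.length_pos
        have := s.I.weight_pos z
        positivity
      calc ∑ s ∈ T, ENNReal.ofReal s.I.length * (ENNReal.ofReal (treeDist T hT z)⁻¹ * V s z)
          = ∑ s ∈ T.filter fun s => s.I.length ≤ 4 * treeDist T hT z,
              ENNReal.ofReal (3 * (treeDist T hT z)⁻¹) *
                ENNReal.ofReal (s.I.length * ((s.I.weight z) ^ 4)⁻¹) := by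
            rw [Finset.sum_filter]
            refine Finset.sum_congr rfl fun s _ => ?_
            rw [hV]
            dsimp only
            split_ifs
            · rw [← ENNReal.ofReal_mul (by positivity), ← ENNReal.ofReal_mul s.I.length_pos.le,
                ← ENNReal.ofReal_mul (by positivity)]
              congr 1
              ring
            · simp
        _ = ENNReal.ofReal (3 * (treeDist T hT z)⁻¹ *
              ∑ s ∈ T.filter fun s => s.I.length ≤ 4 * treeDist T hT z,
                s.I.length * ((s.I.weight z) ^ 4)⁻¹) := by
            rw [ENNReal.ofReal_mul (p := 3 * (treeDist T hT z)⁻¹) (by positivity),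
              ENNReal.ofReal_sum_of_nonneg fun s _ => h2 s, Finset.mul_sum]
        _ ≤ ENNReal.ofReal (3 * (treeDist T hT z)⁻¹ *
              (D * (4 * treeDist T hT z) * ((t.I.weight z) ^ 2)⁻¹)) := by gcongr
        _ = _ := by
            rw [inv_sq_weight, ← ENNReal.ofReal_mul t.I.length_pos.le,
              ← ENNReal.ofReal_mul (by positivity)]
            congr 1
            field_simp
    calc ∑ s ∈ T, ENNReal.ofReal s.I.length * W s
        = ∫⁻ z, ∑ s ∈ T, ENNReal.ofReal s.I.length *
            (ENNReal.ofReal (treeDist T hT z)⁻¹ * V s z) := by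
          rw [lintegral_finsetSum]
          · refine Finset.sum_congr rfl fun s _ => ?_
            rw [lintegral_const_mul' _ _ ENNReal.ofReal_ne_top]
          · intro s _
            have := hVm s
            fun_prop
      _ ≤ ∫⁻ z, ENNReal.ofReal (3 * D * 4) * (ENNReal.ofReal t.I.length *
            ENNReal.ofReal (decayKernel t.I.length (z - t.I.center))) := lintegral_mono hpt
      _ = _ := by
          rw [lintegral_const_mul' _ _ ENNReal.ofReal_ne_top,
            lintegral_const_mul' _ _ ENNReal.ofReal_ne_top, lintegral_decayKernel t.I.length_pos]
  have hone : ∀ s ∈ T, ENNReal.ofReal √s.I.length *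
      ∫⁻ x in {x | (N x ∈ s.ω.toSet ∧ x ∈ H) ∧ s.I.length ≤ 2 * treeDist T hT x},
        ‖packet φ s x‖ₑ ≤
      ENNReal.ofReal A * 3 * density ν N H T * (ENNReal.ofReal s.I.length * W s) := by
    intro s hs
    set E := {x | (N x ∈ s.ω.toSet ∧ x ∈ H) ∧ s.I.length ≤ 2 * treeDist T hT x}
    have hEm : MeasurableSet E :=
      ((hN measurableSet_Ico).inter hH).inter
        (measurableSet_le measurable_const (measurable_treeDist.const_mul 2))
    have h1 : ∀ x ∈ E, ‖packet φ s x‖ₑ ≤ ENNReal.ofReal A * ENNReal.ofReal √s.I.length * (3 * W s) *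
        ENNReal.ofReal (bump ν s.I x) := by
      intro x hx
      rw [← ofReal_norm]
      have hb := bump_nonneg ν s.I x
      calc ENNReal.ofReal ‖packet φ s x‖
          ≤ ENNReal.ofReal (A * (√s.I.length * bump ν s.I x * ((s.I.weight x) ^ 4)⁻¹)) :=
            ENNReal.ofReal_le_ofReal (hφ s x)
        _ = ENNReal.ofReal A * (ENNReal.ofReal √s.I.length * ENNReal.ofReal (bump ν s.I x) *
              ENNReal.ofReal ((s.I.weight x) ^ 4)⁻¹) := by
            rw [ENNReal.ofReal_mul hA.le, ENNReal.ofReal_mul (by positivity),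
              ENNReal.ofReal_mul (by positivity)]
        _ ≤ ENNReal.ofReal A * (ENNReal.ofReal √s.I.length * ENNReal.ofReal (bump ν s.I x) *
              (3 * W s)) := by gcongr; exact hweight s hs x hx.2
        _ = _ := by ring
    have hbm : Measurable fun x => ENNReal.ofReal (bump ν s.I x) := by
      have := s.I.continuous_weight.measurable
      simp_rw [bump_eq]
      fun_prop
    calc ENNReal.ofReal √s.I.length * ∫⁻ x in E, ‖packet φ s x‖ₑ
        ≤ ENNReal.ofReal √s.I.length * ∫⁻ x in E, ENNReal.ofReal A * ENNReal.ofReal √s.I.length *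
            (3 * W s) * ENNReal.ofReal (bump ν s.I x) := by
          gcongr _ * ?_
          exact setLIntegral_mono' hEm h1
      _ = (ENNReal.ofReal √s.I.length * ENNReal.ofReal √s.I.length) * (ENNReal.ofReal A *
            (3 * W s)) * ∫⁻ x in E, ENNReal.ofReal (bump ν s.I x) := by
          rw [lintegral_const_mul _ hbm]; ring
      _ ≤ (ENNReal.ofReal √s.I.length * ENNReal.ofReal √s.I.length) * (ENNReal.ofReal A *
            (3 * W s)) * density ν N H T := by
          gcongr
          refine (lintegral_mono_set ?_).trans
            (lintegral_bump_le_density ν N H (Finset.mem_coe.2 hs) (Tile.Below.refl s))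
          exact fun x hx => hx.1
      _ = _ := by
          rw [← ENNReal.ofReal_mul (by positivity), Real.mul_self_sqrt s.I.length_pos.le]
          ring
  refine (Finset.sum_le_sum hone).trans ?_
  rw [← Finset.mul_sum]
  calc _ ≤ ENNReal.ofReal A * 3 * density ν N H T *
        (ENNReal.ofReal (3 * D * 4) * (ENNReal.ofReal t.I.length * kernelMass)) := by
        gcongr
    _ = _ := by ring

/-! ### The contribution of the points near a tile -/

/-- The points of `H` that interact with some tile of `T` much larger than `treeDist`. -/
noncomputable def activeSet (T : Finset Tile) (hT : T.Nonempty) (N : ℝ → ℝ) (H : Set ℝ) : Set ℝ :=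
  {x | x ∈ H ∧ ∃ s ∈ T, 2 * treeDist T hT x < s.I.length ∧ N x ∈ s.ω.toSet}

section activeSet

variable {T : Finset Tile} {hT : T.Nonempty} {t : Tile} {N : ℝ → ℝ} {H : Set ℝ}

lemma measurableSet_activeSet (hN : Measurable N) (hH : MeasurableSet H) :
    MeasurableSet (activeSet T hT N H) := by
  have : activeSet T hT N H = H ∩ ⋃ s ∈ T, {x | 2 * treeDist T hT x < s.I.length} ∩
      N ⁻¹' s.ω.toSet := by
    ext x
    simp [activeSet, and_left_comm]
  rw [this]
  refine hH.inter (Finset.measurableSet_biUnion _ fun s _ => ?_)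
  exact (measurableSet_lt (by fun_prop) measurable_const).inter (hN measurableSet_Ico)

/-- The active points lie close to the top interval. -/
lemma abs_sub_center_le_of_active (hTt : IsTree T t) {x z : ℝ} (hx : x ∈ activeSet T hT N H)
    (hz : |x - z| ≤ treeDist T hT z / 2) : |z - t.I.center| ≤ 2 * t.I.length := by
  obtain ⟨-, s, hs, hlt, -⟩ := hx
  obtain ⟨s', hs', hs'eq⟩ := exists_treeDist_eq (T := T) (hT := hT) x
  have h1 := (hTt s (Finset.mem_coe.2 hs)).length_le
  have h2 := abs_sub_center_le ((hTt s' (Finset.mem_coe.2 hs')).2 s'.I.center_mem)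
  have h3 := treeDist_le_add (T := T) (hT := hT) z x
  rw [abs_sub_comm z x] at h3
  have h4 := s'.I.length_pos
  have h6 := t.I.length_pos
  have h5 : |z - t.I.center| ≤ |x - z| + |x - s'.I.center| + |s'.I.center - t.I.center| := by
    have := abs_sub_le z x t.I.center
    have := abs_sub_le x s'.I.center t.I.center
    rw [abs_sub_comm z x] at *
    linarith
  linarith

/-- In the ball around `z` of radius half of `treeDist z`, the active points form a set whose
measure is controlled by the density: they all belong to `N⁻¹(ω_{s'})` for a single tile `s'`
above `T`, with `|I_{s'}|` and the distance from `z` to `I_{s'}` comparable to `treeDist z`. -/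
lemma volume_activeSet_inter_le (hTt : IsTree T t) {ν : ℝ} (hν : 0 ≤ ν) (hN : Measurable N)
    (hH : MeasurableSet H) (z : ℝ) :
    volume (activeSet T hT N H ∩ {x | |x - z| ≤ treeDist T hT z / 2}) ≤
      ENNReal.ofReal (6 ^ ν) * density ν N H T * ENNReal.ofReal (treeDist T hT z) := by
  set ρ := treeDist T hT z with hρ
  have hρ0 : 0 < ρ := treeDist_pos z
  set ξ := t.ω.m * t.ω.length with hξ
  obtain ⟨s₀, hs₀, hs₀eq⟩ := exists_treeDist_eq (T := T) (hT := hT) z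
  rw [← hρ] at hs₀eq
  obtain ⟨k, hk1, hk2⟩ := exists_mem_Ico_zpow (y := (2 : ℝ)) hρ0 (by norm_num)
  have hs₀k : s₀.I.k ≤ k := by
    have h1 : s₀.I.length < 2 ^ (k + 1) := by
      have : 0 ≤ |z - s₀.I.center| := abs_nonneg _
      linarith
    have := (zpow_lt_zpow_iff_right₀ (by norm_num : (1 : ℝ) < 2)).1 h1
    omega
  let s' : Tile := ⟨around k s₀.I.center, around (-k) ξ, by
    rw [length_around, length_around, ← zpow_add₀ two_ne_zero]; simp⟩
  have hs'l : s'.I.length = 2 ^ k := rfl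
  have hs'pos := s'.I.length_pos
  have hbelow : s₀.Below s' := by
    constructor
    · rw [Tile.ω_eq_around (hTt.left_mem (Finset.mem_coe.2 hs₀))]
      exact around_subset_around (by omega) ξ
    · rw [eq_around_of_mem s₀.I.center_mem]
      exact around_subset_around hs₀k _
  have hsub : activeSet T hT N H ∩ {x | |x - z| ≤ ρ / 2} ⊆ N ⁻¹' s'.ω.toSet ∩ H := by
    rintro x ⟨⟨hxH, s, hs, hlt, hNs⟩, hxz⟩
    refine ⟨?_, hxH⟩
    have h1 := treeDist_le_add (T := T) (hT := hT) z x
    rw [abs_sub_comm z x, ← hρ] at h1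
    rw [mem_ofPred_eq] at hxz
    have h2 : (2 : ℝ) ^ k < 2 ^ s.I.k := by
      change (2 : ℝ) ^ k < s.I.length
      linarith
    have h3 := (zpow_lt_zpow_iff_right₀ (by norm_num : (1 : ℝ) < 2)).1 h2
    rw [Tile.ω_eq_around (hTt.left_mem (Finset.mem_coe.2 hs))] at hNs
    exact around_subset_around (by omega) ξ hNs
  have hbump : ∀ x ∈ activeSet T hT N H ∩ {x | |x - z| ≤ ρ / 2},
      ENNReal.ofReal (ρ⁻¹ * (6 ^ ν)⁻¹) ≤ ENNReal.ofReal (bump ν s'.I x) := by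
    rintro x ⟨-, hxz⟩
    rw [mem_ofPred_eq] at hxz
    apply ENNReal.ofReal_le_ofReal
    rw [bump_eq, hs'l, Real.rpow_neg (s'.I.weight_pos x).le]
    have hw : s'.I.weight x ≤ 6 := by
      rw [← mul_le_mul_iff_right₀ hs'pos, length_mul_weight, hs'l]
      have h1 : |s₀.I.center - s'.I.center| ≤ s'.I.length / 2 :=
        abs_sub_center_le (mem_around k _)
      rw [hs'l] at h1
      have h2 := abs_sub_le x z s'.I.center
      have h3 := abs_sub_le z s₀.I.center s'.I.center
      have h4 := s₀.I.length_pos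
      rw [zpow_add_one₀ two_ne_zero] at hk2
      linarith
    have := s'.I.weight_pos x
    gcongr
  have hm : MeasurableSet (activeSet T hT N H ∩ {x | |x - z| ≤ ρ / 2}) := by
    refine (measurableSet_activeSet hN hH).inter (measurableSet_le ?_ measurable_const)
    exact (continuous_abs.comp (continuous_id.sub continuous_const)).measurable
  have key : ENNReal.ofReal (ρ⁻¹ * (6 ^ ν)⁻¹) *
      volume (activeSet T hT N H ∩ {x | |x - z| ≤ ρ / 2}) ≤ density ν N H T := by
    rw [← setLIntegral_const]
    exact (setLIntegral_mono' hm hbump).trans ((lintegral_mono_set hsub).trans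
      (lintegral_bump_le_density ν N H (Finset.mem_coe.2 hs₀) hbelow))
  have h6 : (0 : ℝ) < 6 ^ ν := by positivity
  calc volume (activeSet T hT N H ∩ {x | |x - z| ≤ ρ / 2})
      = ENNReal.ofReal (6 ^ ν) * ENNReal.ofReal ρ * (ENNReal.ofReal (ρ⁻¹ * (6 ^ ν)⁻¹) *
          volume (activeSet T hT N H ∩ {x | |x - z| ≤ ρ / 2})) := by
        rw [← mul_assoc, ← ENNReal.ofReal_mul h6.le, ← ENNReal.ofReal_mul (by positivity)]
        have : 6 ^ ν * ρ * (ρ⁻¹ * (6 ^ ν)⁻¹) = 1 := by field_simp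
        rw [this, ENNReal.ofReal_one, one_mul]
    _ ≤ ENNReal.ofReal (6 ^ ν) * ENNReal.ofReal ρ * density ν N H T := by gcongr
    _ = _ := by ring

/-- Integrals over the active set gain the density, provided the integrand is controlled on the
balls of radius half of `treeDist`. -/
lemma lintegral_activeSet_le (hTt : IsTree T t) {ν : ℝ} (hν : 0 ≤ ν) (hN : Measurable N)
    (hH : MeasurableSet H) {Ψ Ψ' : ℝ → ℝ≥0∞} (hΨ' : Measurable Ψ')
    (h : ∀ x ∈ activeSet T hT N H, ∀ z, |x - z| ≤ treeDist T hT z / 2 → Ψ x ≤ Ψ' z) :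
    ∫⁻ x in activeSet T hT N H, Ψ x ≤ 3 * ENNReal.ofReal (6 ^ ν) * density ν N H T *
      ∫⁻ z in Metric.closedBall t.I.center (2 * t.I.length), Ψ' z := by
  set E := activeSet T hT N H with hE
  have hEm : MeasurableSet E := measurableSet_activeSet hN hH
  set Z := Metric.closedBall t.I.center (2 * t.I.length)
  have hZm : MeasurableSet Z := measurableSet_closedBall
  set B : Set (ℝ × ℝ) := {p | |p.1 - p.2| ≤ treeDist T hT p.2 / 2} with hB
  have hBm : MeasurableSet B := by
    refine measurableSet_le ?_ (by fun_prop)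
    exact (continuous_abs.comp (continuous_fst.sub continuous_snd)).measurable
  have hpt : ∀ x ∈ E, Ψ x ≤ 3 * ∫⁻ z, ENNReal.ofReal (treeDist T hT z)⁻¹ *
      (B.indicator 1 (x, z) * Z.indicator Ψ' z) := by
    intro x hx
    refine le_lintegral_of_le_near (x := x) fun z hz => ?_
    have h1 := treeDist_le_add (T := T) (hT := hT) x z
    have h2 := treeDist_pos (T := T) (hT := hT) x
    have h3 : |x - z| ≤ treeDist T hT z / 2 := by linarith
    have h4 : z ∈ Z := by
      rw [Metric.mem_closedBall, Real.dist_eq]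
      exact abs_sub_center_le_of_active hTt hx h3
    rw [indicator_of_mem (show (x, z) ∈ B from h3), indicator_of_mem h4, Pi.one_apply, one_mul]
    exact h x hx z h3
  have hBi : Measurable (B.indicator (1 : ℝ × ℝ → ℝ≥0∞)) := measurable_one.indicator hBm
  have hZi : Measurable (Z.indicator Ψ') := hΨ'.indicator hZm
  calc ∫⁻ x in E, Ψ x
      ≤ ∫⁻ x in E, 3 * ∫⁻ z, ENNReal.ofReal (treeDist T hT z)⁻¹ *
          (B.indicator 1 (x, z) * Z.indicator Ψ' z) := setLIntegral_mono' hEm hpt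
    _ = 3 * ∫⁻ z, ∫⁻ x in E, ENNReal.ofReal (treeDist T hT z)⁻¹ *
          (B.indicator 1 (x, z) * Z.indicator Ψ' z) := by
        rw [lintegral_const_mul' _ _ (by finiteness), lintegral_lintegral_swap]
        refine Measurable.aemeasurable ?_
        simp only [Function.uncurry_def]
        fun_prop
    _ ≤ 3 * ∫⁻ z, ENNReal.ofReal (6 ^ ν) * density ν N H T * Z.indicator Ψ' z := by
        gcongr 3 * ?_
        refine lintegral_mono fun z => ?_
        have h1 : ∫⁻ x in E, ENNReal.ofReal (treeDist T hT z)⁻¹ *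
            (B.indicator 1 (x, z) * Z.indicator Ψ' z) =
            ENNReal.ofReal (treeDist T hT z)⁻¹ * Z.indicator Ψ' z *
              volume (E ∩ {x | |x - z| ≤ treeDist T hT z / 2}) := by
          have h2 : ∀ x, ENNReal.ofReal (treeDist T hT z)⁻¹ *
              (B.indicator 1 (x, z) * Z.indicator Ψ' z) =
              ENNReal.ofReal (treeDist T hT z)⁻¹ * Z.indicator Ψ' z *
                {x | |x - z| ≤ treeDist T hT z / 2}.indicator 1 x := fun x => by
            have : B.indicator (1 : ℝ × ℝ → ℝ≥0∞) (x, z) =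
                {x | |x - z| ≤ treeDist T hT z / 2}.indicator 1 x := rfl
            rw [this]; ring
          have h3 : MeasurableSet {x | |x - z| ≤ treeDist T hT z / 2} := by
            refine measurableSet_le ?_ measurable_const
            exact (continuous_abs.comp (continuous_id.sub continuous_const)).measurable
          simp_rw [h2]
          rw [lintegral_const_mul _ (measurable_one.indicator h3), lintegral_indicator_one h3,
            Measure.restrict_apply h3, inter_comm]
        dsimp only
        rw [h1]
        have hρ := treeDist_pos (T := T) (hT := hT) z
        calc _ ≤ ENNReal.ofReal (treeDist T hT z)⁻¹ * Z.indicator Ψ' z *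
              (ENNReal.ofReal (6 ^ ν) * density ν N H T * ENNReal.ofReal (treeDist T hT z)) := by
              gcongr
              exact volume_activeSet_inter_le hTt hν hN hH z
          _ = (ENNReal.ofReal (treeDist T hT z)⁻¹ * ENNReal.ofReal (treeDist T hT z)) *
              (ENNReal.ofReal (6 ^ ν) * density ν N H T * Z.indicator Ψ' z) := by ring
          _ = _ := by
              rw [← ENNReal.ofReal_mul (by positivity), inv_mul_cancel₀ hρ.ne', ENNReal.ofReal_one,
                one_mul]
    _ = _ := by
        rw [lintegral_const_mul _ hZi, lintegral_indicator hZm]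
        ring

end activeSet

/-! ### Size -/

lemma sum_enorm_sq_le_size {φ f : ℝ → ℂ} {S : Set Tile} {T : Finset Tile} {t : Tile}
    (hTS : (T : Set Tile) ⊆ S) (hT : IsPlusTree T t) :
    ∑ s ∈ T, ‖pairing f (packet φ s)‖ₑ ^ 2 ≤ size φ f S ^ 2 * ENNReal.ofReal t.I.length := by
  have hL := t.I.length_pos
  have hL0 : ENNReal.ofReal t.I.length ≠ 0 := by simpa using hL
  have h1 : ENNReal.ofReal t.I.length ^ (-1 / 2 : ℝ) *
      (∑' s : (T : Set Tile), ‖pairing f (packet φ s)‖ₑ ^ 2) ^ (1 / 2 : ℝ) ≤ size φ f S :=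
    (le_iSup₂ (f := fun (_ : (T : Set Tile) ⊆ S) (_ : IsPlusTree T t) =>
      ENNReal.ofReal t.I.length ^ (-1 / 2 : ℝ) *
      (∑' s : (T : Set Tile), ‖pairing f (packet φ s)‖ₑ ^ 2) ^ (1 / 2 : ℝ)) hTS hT).trans
    (le_iSup₂ (f := fun (T : Set Tile) (t : Tile) => ⨆ (_ : T ⊆ S) (_ : IsPlusTree T t),
      ENNReal.ofReal t.I.length ^ (-1 / 2 : ℝ) *
      (∑' s : T, ‖pairing f (packet φ s)‖ₑ ^ 2) ^ (1 / 2 : ℝ)) (T : Set Tile) t)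
  have h2 : ∑' s : (T : Set Tile), ‖pairing f (packet φ s)‖ₑ ^ 2 =
      ∑ s ∈ T, ‖pairing f (packet φ s)‖ₑ ^ 2 :=
    Finset.tsum_subtype' T fun s => ‖pairing f (packet φ s)‖ₑ ^ 2
  rw [h2] at h1
  have h3 : ∀ y : ℝ≥0∞, (y ^ (1 / 2 : ℝ)) ^ 2 = y := fun y => by
    rw [← ENNReal.rpow_natCast, ← ENNReal.rpow_mul]; norm_num
  have h4 : (ENNReal.ofReal t.I.length ^ (-1 / 2 : ℝ)) ^ 2 = (ENNReal.ofReal t.I.length)⁻¹ := by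
    rw [← ENNReal.rpow_natCast, ← ENNReal.rpow_mul, ← ENNReal.rpow_neg_one]; norm_num
  have h5 := pow_le_pow_left₀ (zero_le) h1 2
  rw [mul_pow, h3, h4] at h5
  calc _ = (ENNReal.ofReal t.I.length)⁻¹ * (∑ s ∈ T, ‖pairing f (packet φ s)‖ₑ ^ 2) *
        ENNReal.ofReal t.I.length := by
        rw [mul_right_comm, ENNReal.inv_mul_cancel hL0 ENNReal.ofReal_ne_top, one_mul]
    _ ≤ _ := by gcongr

lemma enorm_pairing_le_size {φ f : ℝ → ℂ} {S : Set Tile} {s : Tile} (hs : s ∈ S) :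
    ‖pairing f (packet φ s)‖ₑ ≤ size φ f S * ENNReal.ofReal √s.I.length := by
  have h := sum_enorm_sq_le_size (φ := φ) (f := f) (S := S) (T := {s}) (t := s)
    (by simpa using hs) ⟨by
      intro s' hs'
      rw [Finset.coe_singleton, mem_singleton_iff] at hs'
      rw [hs']
      exact Tile.Below.refl s, by
      intro s' hs' hne
      rw [Finset.coe_singleton, mem_singleton_iff] at hs'
      exact absurd hs' hne⟩
  rw [Finset.sum_singleton] at h
  have h2 : size φ f S ^ 2 * ENNReal.ofReal s.I.length =
      (size φ f S * ENNReal.ofReal √s.I.length) ^ 2 := by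
    rw [mul_pow, ← ENNReal.ofReal_pow (by positivity), Real.sq_sqrt s.I.length_pos.le]
  rw [h2] at h
  exact (ENNReal.pow_le_pow_left_iff two_ne_zero).1 h

/-- The tiles of a tree whose upper frequency half contains the lower left corner of the top
form a `+`tree. -/
lemma IsTree.isPlusTree {T : Set Tile} {t : Tile} (h : IsTree T t)
    (hu : ∀ s ∈ T, t.ω.m * t.ω.length ∈ s.ω.upper.toSet) : IsPlusTree T t :=
  ⟨h, fun s hs _ => ⟨(s.I.m * s.I.length, t.ω.m * t.ω.length),
    ⟨(h s hs).2 s.I.left_mem, t.ω.left_mem⟩, ⟨s.I.left_mem, hu s hs⟩⟩⟩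

/-! ### The companion functions -/

lemma mem_scaleSet_iff {lm lp : ℝ → ℤ} {s : Tile} {x : ℝ} :
    x ∈ scaleSet lm lp s ↔ lm x ≤ s.I.k ∧ s.I.k < lp x := by
  have h2 : (1 : ℝ) < 2 := by norm_num
  change (2 : ℝ) ^ lm x ≤ 2 ^ s.I.k ∧ (2 : ℝ) ^ s.I.k < 2 ^ lp x ↔ _
  rw [zpow_le_zpow_iff_right₀ h2, zpow_lt_zpow_iff_right₀ h2]

lemma companion_eq_ite (φ : ℝ → ℂ) (N a : ℝ → ℝ) (lm lp : ℝ → ℤ) (s : Tile) (x : ℝ)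
    [Decidable ((lm x ≤ s.I.k ∧ s.I.k < lp x) ∧ N x ∈ s.ω.upper.toSet)] :
    companion φ N a lm lp s x =
      if (lm x ≤ s.I.k ∧ s.I.k < lp x) ∧ N x ∈ s.ω.upper.toSet then a x * packet φ s x else 0 := by
  unfold companion ind
  by_cases h1 : lm x ≤ s.I.k ∧ s.I.k < lp x
  · rw [indicator_of_mem (mem_scaleSet_iff.2 h1)]
    by_cases h2 : N x ∈ s.ω.upper.toSet
    · rw [indicator_of_mem h2, if_pos ⟨h1, h2⟩]; ring
    · rw [indicator_of_notMem h2, if_neg fun h => h2 h.2]; ring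
  · rw [indicator_of_notMem (mt mem_scaleSet_iff.1 h1), if_neg fun h => h1 h.1]; ring

lemma measurable_companion (φ : 𝓢(ℝ, ℂ)) {N a : ℝ → ℝ} {lm lp : ℝ → ℤ} (hN : Measurable N)
    (ha : Measurable a) (hlm : Measurable lm) (hlp : Measurable lp) (s : Tile) :
    Measurable (companion φ N a lm lp s) := by
  classical
  have h : companion φ N a lm lp s = _ := funext fun x => companion_eq_ite φ N a lm lp s x
  rw [h]
  have hp := (continuous_packet φ s).measurable
  refine Measurable.ite ?_ (by fun_prop) measurable_const
  exact ((measurableSet_le hlm measurable_const).inter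
    (measurableSet_lt measurable_const hlp)).inter (hN measurableSet_Ico)

/-- At each point, at most one of the functions `f_{s,j}` is nonzero. -/
lemma sum_enorm_companion_le (φ : ℝ → ℂ) (N : ℝ → ℝ) {k : ℕ → ℤ} (hk : StrictMono k)
    {α : ℕ → ℝ → ℝ} (hα : ∀ j x, |α j x| ≤ 1) {lm lp : ℕ → ℝ → ℤ}
    (hl : ∀ j x, k j ≤ lm j x ∧ lm j x < lp j x ∧ lp j x < k (j + 1)) (J : Finset ℕ) (s : Tile)
    (x : ℝ) : ∑ j ∈ J, ‖companion φ N (α j) (lm j) (lp j) s x‖ₑ ≤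
      (N ⁻¹' s.ω.upper.toSet).indicator (fun x => ‖packet φ s x‖ₑ) x := by
  classical
  simp_rw [companion_eq_ite]
  by_cases hN : N x ∈ s.ω.upper.toSet
  · rw [indicator_of_mem (show x ∈ N ⁻¹' s.ω.upper.toSet from hN)]
    by_cases hex : ∃ j ∈ J, lm j x ≤ s.I.k ∧ s.I.k < lp j x
    · obtain ⟨j, hj, hjs⟩ := hex
      rw [Finset.sum_eq_single_of_mem j hj]
      · rw [if_pos ⟨hjs, hN⟩, enorm_mul]
        calc _ ≤ 1 * ‖packet φ s x‖ₑ := by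
              gcongr
              rw [← ofReal_norm, Complex.norm_real, Real.norm_eq_abs, ENNReal.ofReal_le_one]
              exact hα j x
          _ = _ := one_mul _
      · intro i _ hij
        rw [if_neg, enorm_zero]
        rintro ⟨his, -⟩
        have h1 := hl i x
        have h2 := hl j x
        rcases lt_or_gt_of_ne hij with h | h
        · have := hk.monotone (Nat.succ_le_of_lt h)
          simp only [Nat.succ_eq_add_one] at this
          omega
        · have := hk.monotone (Nat.succ_le_of_lt h)
          simp only [Nat.succ_eq_add_one] at this
          omega
    · rw [Finset.sum_eq_zero]
      · exact zero_le
      · intro j hj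
        rw [if_neg, enorm_zero]
        exact fun h => hex ⟨j, hj, h.1⟩
  · rw [Finset.sum_eq_zero]
    · exact zero_le
    · intro j _
      rw [if_neg, enorm_zero]
      exact fun h => hN h.2

lemma norm_companion_le (φ : ℝ → ℂ) (N : ℝ → ℝ) {a : ℝ → ℝ} (ha : ∀ x, |a x| ≤ 1)
    (lm lp : ℝ → ℤ) (s : Tile) (x : ℝ) : ‖companion φ N a lm lp s x‖ ≤ ‖packet φ s x‖ := by
  classical
  rw [companion_eq_ite]
  split_ifs
  · rw [norm_mul, Complex.norm_real, Real.norm_eq_abs]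
    exact mul_le_of_le_one_left (norm_nonneg _) (ha x)
  · simp

/-- Sum over `j` of the integrals of `|f_{s,j}|` over a set. -/
lemma sum_lintegral_companion_le (φ : 𝓢(ℝ, ℂ)) {N : ℝ → ℝ} (hN : Measurable N) {k : ℕ → ℤ}
    (hk : StrictMono k) {α : ℕ → ℝ → ℝ} (hαm : ∀ j, Measurable (α j)) (hα : ∀ j x, |α j x| ≤ 1)
    {lm lp : ℕ → ℝ → ℤ} (hlm : ∀ j, Measurable (lm j)) (hlp : ∀ j, Measurable (lp j))
    (hl : ∀ j x, k j ≤ lm j x ∧ lm j x < lp j x ∧ lp j x < k (j + 1))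
    {H : Set ℝ} (hH : MeasurableSet H) (J : Finset ℕ) (s : Tile) (A : Set ℝ) :
    ∑ j ∈ J, ‖∫ x in A, ind H x * conj (companion φ N (α j) (lm j) (lp j) s x)‖ₑ ≤
      ∫⁻ x in {x | N x ∈ s.ω.upper.toSet ∧ x ∈ H} ∩ A, ‖packet φ s x‖ₑ := by
  have hB : MeasurableSet {x | N x ∈ s.ω.upper.toSet ∧ x ∈ H} := (hN measurableSet_Ico).inter hH
  have hm : ∀ j, Measurable (companion φ N (α j) (lm j) (lp j) s) := fun j =>
    measurable_companion φ hN (hαm j) (hlm j) (hlp j) s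
  have hH1 : Measurable (H.indicator (1 : ℝ → ℝ≥0∞)) := measurable_one.indicator hH
  calc _ ≤ ∑ j ∈ J, ∫⁻ x in A, H.indicator 1 x * ‖companion φ N (α j) (lm j) (lp j) s x‖ₑ := by
        refine Finset.sum_le_sum fun j _ => (enorm_integral_le_lintegral_enorm _).trans
          (le_of_eq (lintegral_congr fun x => ?_))
        rw [enorm_mul, RCLike.enorm_conj]
        congr 1
        by_cases hx : x ∈ H <;> simp [ind, hx]
    _ = ∫⁻ x in A, H.indicator 1 x * ∑ j ∈ J, ‖companion φ N (α j) (lm j) (lp j) s x‖ₑ := by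
        rw [← lintegral_finsetSum]
        · simp_rw [Finset.mul_sum]
        · intro j _
          have := (hm j).enorm
          fun_prop
    _ ≤ ∫⁻ x in A, {x | N x ∈ s.ω.upper.toSet ∧ x ∈ H}.indicator (fun x => ‖packet φ s x‖ₑ) x := by
        refine lintegral_mono fun x => ?_
        dsimp only
        by_cases hx : x ∈ H
        · rw [indicator_of_mem hx, Pi.one_apply, one_mul]
          refine (sum_enorm_companion_le φ N hk hα hl J s x).trans (le_of_eq ?_)
          by_cases hNx : N x ∈ s.ω.upper.toSet
          · rw [indicator_of_mem (show x ∈ N ⁻¹' s.ω.upper.toSet from hNx),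
              indicator_of_mem (show x ∈ {x | N x ∈ s.ω.upper.toSet ∧ x ∈ H} from ⟨hNx, hx⟩)]
          · rw [indicator_of_notMem (show x ∉ N ⁻¹' s.ω.upper.toSet from hNx),
              indicator_of_notMem fun h => hNx h.1]
        · simp [hx]
    _ = _ := setLIntegral_indicator hB _

lemma integrable_ind_mul_companion (φ : 𝓢(ℝ, ℂ)) {N a : ℝ → ℝ} {lm lp : ℝ → ℤ}
    (hN : Measurable N) (ha : Measurable a) (ha1 : ∀ x, |a x| ≤ 1) (hlm : Measurable lm)
    (hlp : Measurable lp) {H : Set ℝ} (hH : MeasurableSet H) (s : Tile) :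
    Integrable fun x => ind H x * conj (companion φ N a lm lp s x) := by
  have h1 : Measurable (ind H) := measurable_const.indicator hH
  have h2 : Measurable fun x => conj (companion φ N a lm lp s x) :=
    Complex.continuous_conj.measurable.comp (measurable_companion φ hN ha hlm hlp s)
  refine (integrable_packet φ s).norm.mono' (h1.mul h2).aestronglyMeasurable
    (Filter.Eventually.of_forall fun x => ?_)
  rw [norm_mul, RCLike.norm_conj]
  calc _ ≤ 1 * ‖packet φ s x‖ := by
        gcongr
        · by_cases hx : x ∈ H <;> simp [ind, hx]
        · exact norm_companion_le φ N ha1 lm lp s x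
    _ = _ := one_mul _

/-! ### Tiles with the top in the lower frequency half -/

/-- Near a tile, for the tiles with `ω_t ⊆ ω_{s-}`: the intervals `ω_{s+}` of different scales are
disjoint, so that at each point a single scale contributes. -/
lemma exists_near_lower_le (φ : 𝓢(ℝ, ℂ)) {ν : ℝ} (hν : 0 ≤ ν) : ∃ C : ℝ≥0∞, C ≠ ⊤ ∧
    ∀ (T : Finset Tile) (hT : T.Nonempty) (t : Tile), IsTree T t →
    ∀ (T' : Finset Tile), T' ⊆ T → (∀ s ∈ T', t.ω.m * t.ω.length ∉ s.ω.upper.toSet) →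
    ∀ (N : ℝ → ℝ), Measurable N → ∀ (H : Set ℝ), MeasurableSet H →
      ∑ s ∈ T', ENNReal.ofReal √s.I.length *
        ∫⁻ x in {x | N x ∈ s.ω.upper.toSet ∧ x ∈ H} ∩ {x | 2 * treeDist T hT x < s.I.length},
          ‖packet φ s x‖ₑ ≤ C * density ν N H T * ENNReal.ofReal t.I.length := by
  obtain ⟨A, hA, hφ⟩ := exists_norm_packet_le_kernel φ
  obtain ⟨D, hD, hsum⟩ := exists_sum_weight_le
  refine ⟨ENNReal.ofReal (A * D) * (3 * ENNReal.ofReal (6 ^ ν)) * ENNReal.ofReal 4,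
    by finiteness, fun T hT t hTt T' hT' hlow N hN H hH => ?_⟩
  classical
  set ξ := t.ω.m * t.ω.length
  have hξ : ∀ s ∈ T', ξ ∈ s.ω.toSet := fun s hs => hTt.left_mem (Finset.mem_coe.2 (hT' hs))
  set B : Tile → Set ℝ := fun s =>
    {x | N x ∈ s.ω.upper.toSet ∧ x ∈ H} ∩ {x | 2 * treeDist T hT x < s.I.length} with hB
  have hBm : ∀ s, MeasurableSet (B s) := fun s =>
    ((hN measurableSet_Ico).inter hH).inter
      (measurableSet_lt (measurable_treeDist.const_mul 2) measurable_const)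
  set E := activeSet T hT N H
  have hE : MeasurableSet E := measurableSet_activeSet hN hH
  have hpt : ∀ x, ∑ s ∈ T', (B s).indicator
      (fun x => ENNReal.ofReal √s.I.length * ‖packet φ s x‖ₑ) x ≤
      E.indicator (fun _ => ENNReal.ofReal (A * D)) x := by
    intro x
    simp_rw [indicator_apply]
    rw [← Finset.sum_filter]
    rcases (T'.filter fun s => x ∈ B s).eq_empty_or_nonempty with h0 | ⟨s₀, hs₀⟩
    · rw [h0, Finset.sum_empty]; exact zero_le
    rw [Finset.mem_filter] at hs₀
    have hxE : x ∈ E := ⟨hs₀.2.1.2, s₀, hT' hs₀.1, hs₀.2.2, upper_subset _ hs₀.2.1.1⟩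
    have hdisj : ∀ s ∈ T', ∀ s' ∈ T', x ∈ B s → x ∈ B s' → ¬ s.I.k < s'.I.k := by
      intro s hs s' hs' hx hx' hlt
      have h1 := Tile.ω_subset_lower_of_lt (hξ s hs) (hlow s hs) (hξ s' hs') hlt
        (upper_subset _ hx'.1.1)
      have h2 := hx.1.1
      rw [mem_lower_iff] at h1
      rw [mem_upper_iff] at h2
      linarith [h1.2, h2.1]
    have hk : ∀ s ∈ T'.filter fun s => x ∈ B s, s.I.k = s₀.I.k := by
      intro s hs
      rw [Finset.mem_filter] at hs
      exact le_antisymm (not_lt.1 (hdisj s₀ hs₀.1 s hs.1 hs₀.2 hs.2))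
        (not_lt.1 (hdisj s hs.1 s₀ hs₀.1 hs.2 hs₀.2))
    have h1 := hsum (T'.filter fun s => x ∈ B s) ξ s₀.I.k
      (fun s hs => hξ s (Finset.mem_filter.1 hs).1) hk x
    rw [if_pos hxE]
    calc ∑ s ∈ T' with x ∈ B s, ENNReal.ofReal √s.I.length * ‖packet φ s x‖ₑ
        ≤ ∑ s ∈ T' with x ∈ B s, ENNReal.ofReal (A * ((s.I.weight x) ^ 2)⁻¹) := by
          refine Finset.sum_le_sum fun s _ => ?_
          rw [← ofReal_norm, ← ENNReal.ofReal_mul (by positivity), inv_sq_weight]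
          apply ENNReal.ofReal_le_ofReal
          calc √s.I.length * ‖packet φ s x‖ ≤ √s.I.length *
                (A * (√s.I.length * decayKernel s.I.length (x - s.I.center))) := by
                gcongr; exact hφ s x
            _ = A * ((√s.I.length * √s.I.length) *
                  decayKernel s.I.length (x - s.I.center)) := by ring
            _ = _ := by rw [Real.mul_self_sqrt s.I.length_pos.le]
      _ = ENNReal.ofReal (A * ∑ s ∈ T' with x ∈ B s, ((s.I.weight x) ^ 2)⁻¹) := by
          rw [Finset.mul_sum, ENNReal.ofReal_sum_of_nonneg]
          intro s _
          positivity
      _ ≤ _ := by gcongr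
  have hpm : ∀ s, Measurable fun x => ENNReal.ofReal √s.I.length * ‖packet φ s x‖ₑ := fun s => by
    have := (continuous_packet φ s).measurable.enorm
    fun_prop
  calc ∑ s ∈ T', ENNReal.ofReal √s.I.length * ∫⁻ x in B s, ‖packet φ s x‖ₑ
      = ∫⁻ x, ∑ s ∈ T', (B s).indicator
          (fun x => ENNReal.ofReal √s.I.length * ‖packet φ s x‖ₑ) x := by
        rw [lintegral_finsetSum]
        · refine Finset.sum_congr rfl fun s _ => ?_
          rw [lintegral_indicator (hBm s), lintegral_const_mul' _ _ ENNReal.ofReal_ne_top]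
        · exact fun s _ => (hpm s).indicator (hBm s)
    _ ≤ ∫⁻ x, E.indicator (fun _ => ENNReal.ofReal (A * D)) x := lintegral_mono hpt
    _ = ENNReal.ofReal (A * D) * ∫⁻ x in E, 1 := by
        rw [lintegral_indicator hE, setLIntegral_const, setLIntegral_one]
    _ ≤ ENNReal.ofReal (A * D) * (3 * ENNReal.ofReal (6 ^ ν) * density ν N H T *
          ∫⁻ _ in Metric.closedBall t.I.center (2 * t.I.length), 1) := by
        gcongr _ * ?_
        exact lintegral_activeSet_le hTt hν hN hH measurable_const fun _ _ _ _ => le_rfl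
    _ = _ := by
        have h4 : 2 * (2 * t.I.length) = 4 * t.I.length := by ring
        rw [setLIntegral_one, Real.volume_closedBall, h4, ENNReal.ofReal_mul (p := 4) (by norm_num)]
        ring

/-! ### Tiles with the top in the upper frequency half -/

lemma sum_disjoint_blocks_le {k : ℕ → ℤ} (hk : StrictMono k) (J : Finset ℕ) (T : Finset Tile)
    (c : Tile → ℝ≥0∞) :
    ∑ j ∈ J, ∑ s ∈ T with k j ≤ s.I.k ∧ s.I.k < k (j + 1), c s ≤ ∑ s ∈ T, c s := by
  simp_rw [Finset.sum_filter]
  rw [Finset.sum_comm]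
  refine Finset.sum_le_sum fun s _ => ?_
  rw [← Finset.sum_filter, Finset.sum_const]
  have hcard : (J.filter fun j => k j ≤ s.I.k ∧ s.I.k < k (j + 1)).card ≤ 1 := by
    refine Finset.card_le_one.2 fun i hi j hj => ?_
    rw [Finset.mem_filter] at hi hj
    by_contra hne
    rcases lt_or_gt_of_ne hne with h | h
    · have := hk.monotone (Nat.succ_le_of_lt h)
      simp only [Nat.succ_eq_add_one] at this
      omega
    · have := hk.monotone (Nat.succ_le_of_lt h)
      simp only [Nat.succ_eq_add_one] at this
      omega
  calc _ ≤ 1 • c s := by gcongr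
    _ = c s := one_smul _ _

lemma enorm_sum_mul_sq_le {J : Finset ℕ} {a : ℕ → ℝ} (ha : ∑ j ∈ J, |a j| ^ 2 ≤ 1)
    (d : ℕ → ℂ) : ‖∑ j ∈ J, (a j : ℂ) * d j‖ₑ ^ 2 ≤ ∑ j ∈ J, ‖d j‖ₑ ^ 2 := by
  have h : ‖∑ j ∈ J, (a j : ℂ) * d j‖ ^ 2 ≤ ∑ j ∈ J, ‖d j‖ ^ 2 := by
    calc ‖∑ j ∈ J, (a j : ℂ) * d j‖ ^ 2 ≤ (∑ j ∈ J, |a j| * ‖d j‖) ^ 2 := by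
          gcongr
          refine (norm_sum_le _ _).trans (Finset.sum_le_sum fun j _ => ?_)
          rw [norm_mul, Complex.norm_real, Real.norm_eq_abs]
      _ ≤ (∑ j ∈ J, |a j| ^ 2) * ∑ j ∈ J, ‖d j‖ ^ 2 := Finset.sum_mul_sq_le_sq_mul_sq _ _ _
      _ ≤ 1 * ∑ j ∈ J, ‖d j‖ ^ 2 := by gcongr
      _ = _ := one_mul _
  calc _ = ENNReal.ofReal (‖∑ j ∈ J, (a j : ℂ) * d j‖ ^ 2) := by
        rw [ENNReal.ofReal_pow (norm_nonneg _), ofReal_norm]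
    _ ≤ ENNReal.ofReal (∑ j ∈ J, ‖d j‖ ^ 2) := ENNReal.ofReal_le_ofReal h
    _ = _ := by
        rw [ENNReal.ofReal_sum_of_nonneg fun j _ => by positivity]
        refine Finset.sum_congr rfl fun j _ => ?_
        rw [ENNReal.ofReal_pow (norm_nonneg _), ofReal_norm]

/-- The `L²` bound for the square function of the maximal averages of finitely many
superpositions over lacunary families. -/
lemma exists_squareFunction_le (φ : 𝓢(ℝ, ℂ)) {r : ℝ} (hφ : FreqSupportedIn φ r)
    (hr : r ≤ 1 / 16) : ∃ C : ℝ≥0∞, C ≠ ⊤ ∧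
    ∀ (J : Finset ℕ) (T : ℕ → Finset Tile) (ξ : ℝ),
      (∀ j, ∀ s ∈ T j, ξ ∈ s.ω.upper.toSet) → ∀ (b : ℕ → Tile → ℂ) (S : Finset ℤ),
      ∫⁻ z, ∑ j ∈ J, (⨆ a ∈ S, kernelAvg (2 ^ a) (fun y => ‖superpose φ (T j) (b j) y‖ₑ) z) ^ 2 ≤
        C * ∑ j ∈ J, ∑ s ∈ T j, ‖b j s‖ₑ ^ 2 := by
  obtain ⟨C, hC, horth⟩ := exists_superpose_le φ hφ hr
  refine ⟨(8 * kernelMass) ^ 2 * C, by have := kernelMass_ne_top; finiteness,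
    fun J T ξ hξ b S => ?_⟩
  have hm : ∀ j, Measurable fun y => ‖superpose φ (T j) (b j) y‖ₑ := fun j =>
    (continuous_superpose φ (T j) (b j)).measurable.enorm
  rw [lintegral_finsetSum, Finset.mul_sum]
  · refine Finset.sum_le_sum fun j _ => ?_
    have h1 := horth (T j) ξ (hξ j) (b j)
    have hfin : C * ∑ s ∈ T j, ‖b j s‖ₑ ^ 2 ≠ ⊤ :=
      ENNReal.mul_ne_top hC (ENNReal.sum_ne_top.2 fun s _ => by finiteness)
    calc _ ≤ (8 * kernelMass) ^ 2 * ∫⁻ y, ‖superpose φ (T j) (b j) y‖ₑ ^ 2 :=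
          lintegral_iSup_kernelAvg_sq_le S (hm j) (ne_top_of_le_ne_top hfin h1)
      _ ≤ (8 * kernelMass) ^ 2 * (C * ∑ s ∈ T j, ‖b j s‖ₑ ^ 2) := by gcongr
      _ = _ := by ring
  · intro j _
    refine Measurable.pow_const ?_ 2
    exact .iSup fun a => .iSup fun _ => measurable_kernelAvg measurable_const (hm j)

/-- The pointwise bound behind `exists_near_upper_le`: at an active point `x`, the sum over `j`
and over the tiles near `x` is bounded by the square function of maximal averages, at every `z`
with `|x - z| ≤ treeDist z / 2`. For given `j` and `x` the tiles that contribute are those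
of a block of scales. -/
lemma exists_near_upper_pointwise_le {r : ℝ} (hr : r ≤ 1 / 16) : ∃ C : ℝ≥0∞, C ≠ ⊤ ∧
    ∀ (φ : 𝓢(ℝ, ℂ)), FreqSupportedIn φ r →
    ∀ (T : Finset Tile) (hT : T.Nonempty) (ξ : ℝ) (T' : Finset Tile), T' ⊆ T →
      (∀ s ∈ T', ξ ∈ s.ω.upper.toSet) →
    ∀ (S : Finset ℤ), (∀ s ∈ T', s.I.k ∈ S ∧ s.I.k + 1 ∈ S) →
    ∀ (N : ℝ → ℝ) (k : ℕ → ℤ) (α : ℕ → ℝ → ℝ) (J : Finset ℕ),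
      (∀ x, ∑ j ∈ J, |α j x| ^ 2 ≤ 1) → ∀ (lm lp : ℕ → ℝ → ℤ),
      (∀ j x, k j ≤ lm j x ∧ lm j x < lp j x ∧ lp j x < k (j + 1)) →
    ∀ (b : ℕ → Tile → ℂ) (x z : ℝ), |x - z| ≤ treeDist T hT z / 2 →
      ‖∑ j ∈ J, ∑ s ∈ T', {x | 2 * treeDist T hT x < s.I.length}.indicator
        (fun x => b j s * companion φ N (α j) (lm j) (lp j) s x) x‖ₑ ^ 2 ≤
      C * ∑ j ∈ J, (⨆ a ∈ S, kernelAvg (2 ^ a) (fun y =>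
        ‖superpose φ (T'.filter fun s => k j ≤ s.I.k ∧ s.I.k < k (j + 1)) (b j) y‖ₑ) z) ^ 2 := by
  obtain ⟨C, hC, hblock⟩ := exists_block_le hr
  refine ⟨C ^ 2, by finiteness, fun φ hφ T hT ξ T' hT' hξ S hS N k α J hα lm lp hl b x z hxz => ?_⟩
  classical
  have hρ : |x - z| ≤ treeDist T hT x := by
    have := treeDist_le_add (T := T) (hT := hT) z x
    rw [abs_sub_comm z x] at this
    linarith
  have hρ0 := treeDist_pos (T := T) (hT := hT) x
  let P : ℕ → Set ℤ := fun j => {κ | (lm j x ≤ κ ∧ κ < lp j x) ∧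
    2 * treeDist T hT x < 2 ^ κ ∧ N x ∈ (around (-κ - 1) ξ).toSet}
  have hP : ∀ j, (P j).OrdConnected := by
    refine fun j => ⟨fun κ₁ h₁ κ₂ h₂ κ hκ => ⟨⟨h₁.1.1.trans hκ.1, hκ.2.trans_lt h₂.1.2⟩, ?_, ?_⟩⟩
    · exact h₁.2.1.trans_le (zpow_le_zpow_right₀ (by norm_num) hκ.1)
    · exact around_subset_around (by have := hκ.2; omega) ξ h₂.2.2
  set T'' : ℕ → Finset Tile := fun j => T'.filter fun s => k j ≤ s.I.k ∧ s.I.k < k (j + 1)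
  have hinner : ∀ j, ∑ s ∈ T', {x | 2 * treeDist T hT x < s.I.length}.indicator
      (fun x => b j s * companion φ N (α j) (lm j) (lp j) s x) x =
      α j x * superpose φ ((T'' j).filter fun s => s.I.k ∈ P j) (b j) x := by
    intro j
    unfold superpose
    rw [Finset.mul_sum, Finset.filter_filter, Finset.sum_filter]
    refine Finset.sum_congr rfl fun s hs => ?_
    rw [indicator_apply, companion_eq_ite, Tile.upper_eq_around (hξ s hs)]
    have hlen : s.I.length = 2 ^ s.I.k := rfl
    have hjx := hl j x
    have hiff : (k j ≤ s.I.k ∧ s.I.k < k (j + 1)) ∧ s.I.k ∈ P j ↔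
        (x ∈ {x | 2 * treeDist T hT x < s.I.length}) ∧
        (lm j x ≤ s.I.k ∧ s.I.k < lp j x) ∧ N x ∈ (around (-s.I.k - 1) ξ).toSet := by
      constructor
      · rintro ⟨-, h1, h2, h3⟩
        exact ⟨h2, h1, h3⟩
      · rintro ⟨h2, h1, h3⟩
        exact ⟨⟨by omega, by omega⟩, h1, h2, h3⟩
    by_cases h : (k j ≤ s.I.k ∧ s.I.k < k (j + 1)) ∧ s.I.k ∈ P j
    · have h' := hiff.1 h
      rw [if_pos h, if_pos h'.1, if_pos h'.2]
      ring
    · have h' := mt hiff.2 h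
      rw [if_neg h]
      split_ifs with h1 h2
      · exact absurd ⟨h1, h2⟩ h'
      · rw [mul_zero]
      · rfl
  simp_rw [hinner]
  refine (enorm_sum_mul_sq_le (hα x) _).trans ?_
  rw [Finset.mul_sum]
  refine Finset.sum_le_sum fun j _ => ?_
  rw [← mul_pow]
  gcongr
  refine hblock φ hφ (T'' j) ξ (fun s hs => hξ s (Finset.mem_filter.1 hs).1) S
    (fun s hs => hS s (Finset.mem_filter.1 hs).1) (P j) (hP j) (b j) x z fun κ hκ => ?_
  have := hκ.2.1
  linarith

/-- Near a tile, for the tiles with `ω_t ⊆ ω_{s+}`. After a choice of unimodular signs the sum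
becomes the integral of a function on the active set that is bounded by the square function of
maximal averages. -/
lemma exists_near_upper_le (φ : 𝓢(ℝ, ℂ)) {r : ℝ} (hφ : FreqSupportedIn φ r) (hr : r ≤ 1 / 16)
    {ν : ℝ} (hν : 0 ≤ ν) : ∃ C : ℝ≥0∞, C ≠ ⊤ ∧
    ∀ (T : Finset Tile) (hT : T.Nonempty) (t : Tile), IsTree T t →
    ∀ (T' : Finset Tile), T' ⊆ T → (∀ s ∈ T', t.ω.m * t.ω.length ∈ s.ω.upper.toSet) →
    ∀ (N : ℝ → ℝ), Measurable N → ∀ (H : Set ℝ), MeasurableSet H →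
    ∀ (k : ℕ → ℤ), StrictMono k → ∀ (α : ℕ → ℝ → ℝ), (∀ j, Measurable (α j)) →
      (∀ j x, |α j x| ≤ 1) → ∀ (J : Finset ℕ), (∀ x, ∑ j ∈ J, |α j x| ^ 2 ≤ 1) →
    ∀ (lm lp : ℕ → ℝ → ℤ), (∀ j, Measurable (lm j)) → (∀ j, Measurable (lp j)) →
      (∀ j x, k j ≤ lm j x ∧ lm j x < lp j x ∧ lp j x < k (j + 1)) →
    ∀ (a : Tile → ℂ) (σ : ℝ≥0∞), ∑ s ∈ T', ‖a s‖ₑ ^ 2 ≤ σ ^ 2 * ENNReal.ofReal t.I.length →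
      ∑ j ∈ J, ∑ s ∈ T', ‖a s * ∫ x in {x | 2 * treeDist T hT x < s.I.length},
        ind H x * conj (companion φ N (α j) (lm j) (lp j) s x)‖ₑ ≤
      C * σ * density ν N H T * ENNReal.ofReal t.I.length := by
  obtain ⟨C₁, hC₁, hpt⟩ := exists_near_upper_pointwise_le hr
  obtain ⟨C₂, hC₂, hsq⟩ := exists_squareFunction_le φ hφ hr
  -- this constant is only chosen to satisfy `4 * (C₁ * C₂) ≤ C₃ ^ 2`
  set C₃ := 4 * (C₁ * C₂) + 1 with hC₃
  refine ⟨3 * ENNReal.ofReal (6 ^ ν) * C₃, by finiteness,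
    fun T hT t hTt T' hT' hup N hN H hH k hk α hαm hα J hα2 lm lp hlm hlp hl a σ hσ => ?_⟩
  classical
  set ξ := t.ω.m * t.ω.length
  set E := activeSet T hT N H with hE
  have hEm : MeasurableSet E := measurableSet_activeSet hN hH
  set near : Tile → Set ℝ := fun s => {x | 2 * treeDist T hT x < s.I.length} with hnear
  have hnm : ∀ s, MeasurableSet (near s) := fun s =>
    measurableSet_lt (measurable_treeDist.const_mul 2) measurable_const
  set h : ℕ → Tile → ℝ → ℂ := fun j s x =>
    ind H x * conj (companion φ N (α j) (lm j) (lp j) s x) with hh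
  have hhi : ∀ j s, Integrable (h j s) := fun j s =>
    integrable_ind_mul_companion φ hN (hαm j) (hα j) (hlm j) (hlp j) hH s
  set I : ℕ → Tile → ℂ := fun j s => ∫ x in near s, h j s x with hI
  -- the unimodular factors that make all terms nonnegative
  have hu : ∀ w : ℂ, ∃ u : ℂ, ‖u‖ ≤ 1 ∧ u * w = (‖w‖ : ℂ) := by
    intro w
    rcases eq_or_ne w 0 with rfl | hw
    · exact ⟨0, by simp, by simp⟩
    · have hn : (‖w‖ : ℂ) ≠ 0 := by simpa using hw
      refine ⟨conj w / ‖w‖, ?_, ?_⟩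
      · rw [norm_div, RCLike.norm_conj, Complex.norm_real, norm_norm, div_self (by simpa using hw)]
      · rw [div_mul_eq_mul_div, Complex.conj_mul', sq, mul_div_cancel_right₀ _ hn]
  choose u hu1 hu2 using fun (j : ℕ) (s : Tile) => hu (a s * I j s)
  set b : ℕ → Tile → ℂ := fun j s => conj (u j s * a s) with hb
  have hbnorm : ∀ j s, ‖b j s‖ₑ ≤ ‖a s‖ₑ := fun j s => by
    rw [hb, RCLike.enorm_conj, enorm_mul, ← ofReal_norm (u j s)]
    exact mul_le_of_le_one_left' (ENNReal.ofReal_le_one.2 (hu1 j s))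
  set Ψ : ℝ → ℝ≥0∞ := fun x => ‖∑ j ∈ J, ∑ s ∈ T', (near s).indicator
    (fun x => b j s * companion φ N (α j) (lm j) (lp j) s x) x‖ₑ with hΨ
  have hsum : ∑ j ∈ J, ∑ s ∈ T', ‖a s * I j s‖ₑ =
      ‖∫ x, ∑ j ∈ J, ∑ s ∈ T', u j s * a s * (near s).indicator (h j s) x‖ₑ := by
    have h1 : ∫ x, ∑ j ∈ J, ∑ s ∈ T', u j s * a s * (near s).indicator (h j s) x =
        ((∑ j ∈ J, ∑ s ∈ T', ‖a s * I j s‖ : ℝ) : ℂ) := by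
      have hint : ∀ j s, Integrable fun x => u j s * a s * (near s).indicator (h j s) x :=
        fun j s => ((hhi j s).indicator (hnm s)).const_mul _
      rw [integral_finsetSum _ fun j _ => integrable_finsetSum _ fun s _ => hint j s]
      push_cast
      refine Finset.sum_congr rfl fun j _ => ?_
      rw [integral_finsetSum _ fun s _ => hint j s]
      refine Finset.sum_congr rfl fun s _ => ?_
      rw [integral_const_mul, integral_indicator (hnm s), mul_assoc, hu2]
    rw [h1, ← ofReal_norm, Complex.norm_real, Real.norm_of_nonneg (by positivity),
      ENNReal.ofReal_sum_of_nonneg fun j _ => by positivity]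
    refine Finset.sum_congr rfl fun j _ => ?_
    rw [ENNReal.ofReal_sum_of_nonneg fun s _ => by positivity]
    exact Finset.sum_congr rfl fun s _ => (ofReal_norm _).symm
  have hΨle : ∀ x, ‖∑ j ∈ J, ∑ s ∈ T', u j s * a s * (near s).indicator (h j s) x‖ₑ ≤
      E.indicator Ψ x := by
    intro x
    by_cases hx : x ∈ E
    · have h1 : ∑ j ∈ J, ∑ s ∈ T', u j s * a s * (near s).indicator (h j s) x =
          ind H x * conj (∑ j ∈ J, ∑ s ∈ T', (near s).indicator
            (fun x => b j s * companion φ N (α j) (lm j) (lp j) s x) x) := by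
        rw [map_sum, Finset.mul_sum]
        refine Finset.sum_congr rfl fun j _ => ?_
        rw [map_sum, Finset.mul_sum]
        refine Finset.sum_congr rfl fun s _ => ?_
        by_cases hs : x ∈ near s
        · rw [indicator_of_mem hs, indicator_of_mem hs, hh, hb]
          simp only [map_mul, Complex.conj_conj]
          ring
        · rw [indicator_of_notMem hs, indicator_of_notMem hs, map_zero, mul_zero, mul_zero]
      rw [h1, indicator_of_mem hx, enorm_mul, RCLike.enorm_conj]
      have h2 : ‖ind H x‖ₑ ≤ 1 := by
        by_cases hx : x ∈ H <;> simp [ind, hx]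
      exact mul_le_of_le_one_left' h2
    · rw [Finset.sum_eq_zero, enorm_zero]
      · exact zero_le
      · intro j _
        refine Finset.sum_eq_zero fun s hs => ?_
        by_cases hxs : x ∈ near s
        · rw [indicator_of_mem hxs, hh]
          dsimp only
          by_cases hxH : x ∈ H
          · rw [companion_eq_ite, if_neg, map_zero, mul_zero, mul_zero]
            exact fun hc => hx ⟨hxH, s, hT' hs, hxs, upper_subset _ hc.2⟩
          · rw [ind, indicator_of_notMem hxH, zero_mul, mul_zero]
        · rw [indicator_of_notMem hxs, mul_zero]
  set S : Finset ℤ := (T'.image fun s => s.I.k) ∪ T'.image fun s => s.I.k + 1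
  have hS : ∀ s ∈ T', s.I.k ∈ S ∧ s.I.k + 1 ∈ S := fun s hs =>
    ⟨Finset.mem_union_left _ (Finset.mem_image_of_mem (fun s : Tile => s.I.k) hs),
      Finset.mem_union_right _ (Finset.mem_image_of_mem (fun s : Tile => s.I.k + 1) hs)⟩
  set T'' : ℕ → Finset Tile := fun j => T'.filter fun s => k j ≤ s.I.k ∧ s.I.k < k (j + 1)
  set M : ℝ → ℝ≥0∞ := fun z => ∑ j ∈ J,
    (⨆ i ∈ S, kernelAvg (2 ^ i) (fun y => ‖superpose φ (T'' j) (b j) y‖ₑ) z) ^ 2 with hM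
  have hMm : Measurable M := by
    refine Finset.measurable_fun_sum _ fun j _ => Measurable.pow_const ?_ 2
    exact .iSup fun i => .iSup fun _ => measurable_kernelAvg measurable_const
      (continuous_superpose φ _ _).measurable.enorm
  set Ψ' : ℝ → ℝ≥0∞ := fun z => (C₁ * M z) ^ (1 / 2 : ℝ) with hΨ'
  have hΨ'm : Measurable Ψ' := (hMm.const_mul C₁).pow_const _
  have hΨ'sq : ∀ z, Ψ' z ^ 2 = C₁ * M z := fun z => by
    rw [hΨ', ← ENNReal.rpow_natCast, ← ENNReal.rpow_mul]; norm_num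
  have hΨΨ' : ∀ x ∈ E, ∀ z, |x - z| ≤ treeDist T hT z / 2 → Ψ x ≤ Ψ' z := by
    intro x _ z hxz
    refine (ENNReal.pow_le_pow_left_iff two_ne_zero).1 ?_
    rw [hΨ'sq]
    exact hpt φ hφ T hT ξ T' hT' hup S hS N k α J hα2 lm lp hl b x z hxz
  set L := ENNReal.ofReal t.I.length with hL
  have hMint : ∫⁻ z, M z ≤ C₂ * (σ ^ 2 * L) := by
    refine (hsq J T'' ξ (fun j s hs => hup s (Finset.mem_filter.1 hs).1) b S).trans ?_
    gcongr
    calc ∑ j ∈ J, ∑ s ∈ T'' j, ‖b j s‖ₑ ^ 2 ≤ ∑ j ∈ J, ∑ s ∈ T'' j, ‖a s‖ₑ ^ 2 := by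
          gcongr with j _ s _
          exact hbnorm j s
      _ ≤ ∑ s ∈ T', ‖a s‖ₑ ^ 2 := sum_disjoint_blocks_le hk J T' _
      _ ≤ _ := hσ
  have hΨ'int : ∫⁻ z in Metric.closedBall t.I.center (2 * t.I.length), Ψ' z ≤ C₃ * (σ * L) := by
    refine (ENNReal.pow_le_pow_left_iff two_ne_zero).1 ?_
    have h1 := sq_lintegral_mul_le
      (volume.restrict (Metric.closedBall t.I.center (2 * t.I.length)))
      (f := fun _ => 1) (g := Ψ') aemeasurable_const hΨ'm.aemeasurable
    simp only [one_mul, one_pow, lintegral_one, Measure.restrict_apply_univ,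
      Real.volume_closedBall, hΨ'sq] at h1
    have h2 : ENNReal.ofReal (2 * (2 * t.I.length)) = 4 * L := by
      rw [← mul_assoc, ENNReal.ofReal_mul (by norm_num)]
      norm_num
      rfl
    rw [h2] at h1
    have h3 : 4 * (C₁ * C₂) ≤ C₃ ^ 2 := by
      rw [hC₃]
      generalize 4 * (C₁ * C₂) = y
      calc y ≤ y + 1 := le_self_add
        _ = (y + 1) * 1 := (mul_one _).symm
        _ ≤ (y + 1) * (y + 1) := by gcongr; exact le_add_self
        _ = _ := (sq _).symm
    calc _ ≤ 4 * L * ∫⁻ z in Metric.closedBall t.I.center (2 * t.I.length), C₁ * M z := h1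
      _ ≤ 4 * L * ∫⁻ z, C₁ * M z := by gcongr; exact Measure.restrict_le_self
      _ = 4 * L * (C₁ * ∫⁻ z, M z) := by rw [lintegral_const_mul _ hMm]
      _ ≤ 4 * L * (C₁ * (C₂ * (σ ^ 2 * L))) := by gcongr
      _ = 4 * (C₁ * C₂) * (σ * L) ^ 2 := by ring
      _ ≤ C₃ ^ 2 * (σ * L) ^ 2 := by gcongr
      _ = _ := (mul_pow _ _ _).symm
  calc ∑ j ∈ J, ∑ s ∈ T', ‖a s * I j s‖ₑ
      ≤ ∫⁻ x, ‖∑ j ∈ J, ∑ s ∈ T', u j s * a s * (near s).indicator (h j s) x‖ₑ := by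
        rw [hsum]; exact enorm_integral_le_lintegral_enorm _
    _ ≤ ∫⁻ x, E.indicator Ψ x := lintegral_mono hΨle
    _ = ∫⁻ x in E, Ψ x := lintegral_indicator hEm _
    _ ≤ 3 * ENNReal.ofReal (6 ^ ν) * density ν N H T *
          ∫⁻ z in Metric.closedBall t.I.center (2 * t.I.length), Ψ' z :=
        lintegral_activeSet_le hTt hν hN hH hΨ'm hΨΨ'
    _ ≤ 3 * ENNReal.ofReal (6 ^ ν) * density ν N H T * (C₃ * (σ * L)) := by gcongr
    _ = _ := by ring

/-! ### The tree lemma -/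

/-- The tree lemma for finitely many tiles and finitely many `j`. -/
lemma exists_finite_tree_le (φ : 𝓢(ℝ, ℂ)) {r : ℝ} (hφ : FreqSupportedIn φ r) (hr : r ≤ 1 / 16)
    {ν : ℝ} (hν : 0 ≤ ν) : ∃ C : ℝ≥0∞, C ≠ ⊤ ∧
    ∀ (T : Finset Tile) (t : Tile), IsTree T t →
    ∀ (N : ℝ → ℝ), Measurable N → ∀ (G H : Set ℝ), MeasurableSet H →
    ∀ (k : ℕ → ℤ), StrictMono k → ∀ (α : ℕ → ℝ → ℝ), (∀ j, Measurable (α j)) →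
      (∀ j x, |α j x| ≤ 1) → ∀ (J : Finset ℕ), (∀ x, ∑ j ∈ J, |α j x| ^ 2 ≤ 1) →
    ∀ (lm lp : ℕ → ℝ → ℤ), (∀ j, Measurable (lm j)) → (∀ j, Measurable (lp j)) →
      (∀ j x, k j ≤ lm j x ∧ lm j x < lp j x ∧ lp j x < k (j + 1)) →
      ∑ j ∈ J, ∑ s ∈ T, ‖pairing (ind G) (packet φ s) *
        pairing (ind H) (companion φ N (α j) (lm j) (lp j) s)‖ₑ ≤
      C * size φ (ind G) T * density ν N H T * ENNReal.ofReal t.I.length := by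
  obtain ⟨C₁, hC₁, hfar⟩ := exists_far_le φ ν
  obtain ⟨C₂, hC₂, hlow⟩ := exists_near_lower_le φ hν
  obtain ⟨C₃, hC₃, hupp⟩ := exists_near_upper_le φ hφ hr hν
  refine ⟨C₁ + C₂ + C₃, by finiteness,
    fun T t hTt N hN G H hH k hk α hαm hα J hα2 lm lp hlm hlp hl => ?_⟩
  classical
  rcases T.eq_empty_or_nonempty with rfl | hT
  · simp
  set ξ := t.ω.m * t.ω.length
  set a : Tile → ℂ := fun s => pairing (ind G) (packet φ s)
  set σ := size φ (ind G) T
  have ha : ∀ s ∈ T, ‖a s‖ₑ ≤ σ * ENNReal.ofReal √s.I.length := fun s hs =>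
    enorm_pairing_le_size (Finset.mem_coe.2 hs)
  set h : ℕ → Tile → ℝ → ℂ := fun j s x =>
    ind H x * conj (companion φ N (α j) (lm j) (lp j) s x) with hh
  have hhi : ∀ j s, Integrable (h j s) := fun j s =>
    integrable_ind_mul_companion φ hN (hαm j) (hα j) (hlm j) (hlp j) hH s
  set near : Tile → Set ℝ := fun s => {x | 2 * treeDist T hT x < s.I.length} with hnear
  set far : Tile → Set ℝ := fun s => {x | s.I.length ≤ 2 * treeDist T hT x} with hfard
  have hnm : ∀ s, MeasurableSet (near s) := fun s =>
    measurableSet_lt (measurable_treeDist.const_mul 2) measurable_const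
  have hcompl : ∀ s, (near s)ᶜ = far s := fun s => by
    ext x; simp [hnear, hfard]
  set Tu := T.filter fun s => ξ ∈ s.ω.upper.toSet
  set Tl := T.filter fun s => ξ ∉ s.ω.upper.toSet
  have hTu : Tu ⊆ T := Finset.filter_subset _ _
  have hTl : Tl ⊆ T := Finset.filter_subset _ _
  have hsplit : ∀ j s, ‖a s * pairing (ind H) (companion φ N (α j) (lm j) (lp j) s)‖ₑ ≤
      ‖a s‖ₑ * ‖∫ x in far s, h j s x‖ₑ + ‖a s * ∫ x in near s, h j s x‖ₑ := by
    intro j s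
    have h1 : pairing (ind H) (companion φ N (α j) (lm j) (lp j) s) =
        (∫ x in far s, h j s x) + ∫ x in near s, h j s x := by
      rw [add_comm, ← hcompl]
      exact (integral_add_compl (hnm s) (hhi j s)).symm
    rw [h1, mul_add, ← enorm_mul]
    exact enorm_add_le _ _
  have hF : ∑ j ∈ J, ∑ s ∈ T, ‖a s‖ₑ * ‖∫ x in far s, h j s x‖ₑ ≤
      C₁ * σ * density ν N H T * ENNReal.ofReal t.I.length := by
    rw [Finset.sum_comm]
    calc ∑ s ∈ T, ∑ j ∈ J, ‖a s‖ₑ * ‖∫ x in far s, h j s x‖ₑ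
        ≤ ∑ s ∈ T, σ * (ENNReal.ofReal √s.I.length *
            ∫⁻ x in {x | (N x ∈ s.ω.toSet ∧ x ∈ H) ∧ s.I.length ≤ 2 * treeDist T hT x},
              ‖packet φ s x‖ₑ) := by
          refine Finset.sum_le_sum fun s hs => ?_
          rw [← Finset.mul_sum, ← mul_assoc]
          gcongr
          · exact ha s hs
          · refine (sum_lintegral_companion_le φ hN hk hαm hα hlm hlp hl hH J s (far s)).trans
              (lintegral_mono_set ?_)
            exact fun x hx => ⟨⟨upper_subset _ hx.1.1, hx.1.2⟩, hx.2⟩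
      _ ≤ σ * (C₁ * density ν N H T * ENNReal.ofReal t.I.length) := by
          rw [← Finset.mul_sum]
          gcongr
          exact hfar T hT t hTt N hN H hH
      _ = _ := by ring
  have hNl : ∑ j ∈ J, ∑ s ∈ Tl, ‖a s * ∫ x in near s, h j s x‖ₑ ≤
      C₂ * σ * density ν N H T * ENNReal.ofReal t.I.length := by
    rw [Finset.sum_comm]
    calc ∑ s ∈ Tl, ∑ j ∈ J, ‖a s * ∫ x in near s, h j s x‖ₑ
        ≤ ∑ s ∈ Tl, σ * (ENNReal.ofReal √s.I.length *
            ∫⁻ x in {x | N x ∈ s.ω.upper.toSet ∧ x ∈ H} ∩ near s, ‖packet φ s x‖ₑ) := by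
          refine Finset.sum_le_sum fun s hs => ?_
          simp_rw [enorm_mul]
          rw [← Finset.mul_sum, ← mul_assoc]
          gcongr
          · exact ha s (hTl hs)
          · exact sum_lintegral_companion_le φ hN hk hαm hα hlm hlp hl hH J s (near s)
      _ ≤ σ * (C₂ * density ν N H T * ENNReal.ofReal t.I.length) := by
          rw [← Finset.mul_sum]
          gcongr
          exact hlow T hT t hTt Tl hTl (fun s hs => (Finset.mem_filter.1 hs).2) N hN H hH
      _ = _ := by ring
  have hNu : ∑ j ∈ J, ∑ s ∈ Tu, ‖a s * ∫ x in near s, h j s x‖ₑ ≤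
      C₃ * σ * density ν N H T * ENNReal.ofReal t.I.length := by
    refine hupp T hT t hTt Tu hTu (fun s hs => (Finset.mem_filter.1 hs).2) N hN H hH k hk α hαm hα
      J hα2 lm lp hlm hlp hl a σ (sum_enorm_sq_le_size (Finset.coe_subset.2 hTu) ?_)
    exact IsTree.isPlusTree (fun s hs => hTt s (Finset.coe_subset.2 hTu hs))
      fun s hs => (Finset.mem_filter.1 (Finset.mem_coe.1 hs)).2
  calc _ ≤ ∑ j ∈ J, ∑ s ∈ T, (‖a s‖ₑ * ‖∫ x in far s, h j s x‖ₑ +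
          ‖a s * ∫ x in near s, h j s x‖ₑ) :=
        Finset.sum_le_sum fun j _ => Finset.sum_le_sum fun s _ => hsplit j s
    _ = (∑ j ∈ J, ∑ s ∈ T, ‖a s‖ₑ * ‖∫ x in far s, h j s x‖ₑ) +
          ((∑ j ∈ J, ∑ s ∈ Tu, ‖a s * ∫ x in near s, h j s x‖ₑ) +
            ∑ j ∈ J, ∑ s ∈ Tl, ‖a s * ∫ x in near s, h j s x‖ₑ) := by
        simp_rw [Finset.sum_add_distrib]
        congr 1
        rw [← Finset.sum_add_distrib]
        refine Finset.sum_congr rfl fun j _ => ?_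
        exact (Finset.sum_filter_add_sum_filter_not T _ _).symm
    _ ≤ _ := by
        refine (add_le_add hF (add_le_add hNu hNl)).trans (le_of_eq ?_)
        ring

end TimeFreq

theorem lemma11 :
    ∃ ν₀ : ℝ, ∀ ν : ℝ, ν₀ ≤ ν →
    ∀ φ : 𝓢(ℝ, ℂ), TimeFreq.FreqSupportedIn φ (1 / ν) →
    ∃ C : ℝ≥0,
    ∀ (N : ℝ → ℝ), Measurable N →
    ∀ (k : ℕ → ℤ), StrictMono k →
    ∀ (α : ℕ → ℝ → ℝ), (∀ j, Measurable (α j)) →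
      (∀ x, Summable (fun j => |α j x| ^ 2) ∧ ∑' j, |α j x| ^ 2 ≤ 1) →
    ∀ (lm lp : ℕ → ℝ → ℤ), (∀ j, Measurable (lm j)) → (∀ j, Measurable (lp j)) →
      (∀ j x, k j ≤ lm j x ∧ lm j x < lp j x ∧ lp j x < k (j + 1)) →
    ∀ (G H : Set ℝ), MeasurableSet G → MeasurableSet H →
    ∀ (T : Set TimeFreq.Tile) (t : TimeFreq.Tile), TimeFreq.IsTree T t →
      TimeFreq.modelSum φ N α lm lp G H T ≤
        C * TimeFreq.size φ (TimeFreq.ind G) T * TimeFreq.density ν N H T *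
          ENNReal.ofReal t.I.length := by
  -- `1 / ν ≤ 1 / 16` keeps the spectrum of `φ_s` inside `ω_{s-}`, and away from `ω_{s+}` by
  -- `3 / 16 * |ω_s|`
  refine ⟨16, fun ν hν φ hφ => ?_⟩
  have hr : 1 / ν ≤ 1 / 16 := one_div_le_one_div_of_le (by norm_num) hν
  obtain ⟨C, hC, hfin⟩ := TimeFreq.exists_finite_tree_le φ hφ hr (ν := ν) (by linarith)
  refine ⟨C.toNNReal, ?_⟩
  rw [ENNReal.coe_toNNReal hC]
  intro N hN k hk α hαm hα lm lp hlm hlp hl G H _ hH T t hT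
  classical
  have hα2 : ∀ (J : Finset ℕ) (x : ℝ), ∑ j ∈ J, |α j x| ^ 2 ≤ 1 := fun J x =>
    ((hα x).1.sum_le_tsum J fun j _ => by positivity).trans (hα x).2
  have hα1 : ∀ j x, |α j x| ≤ 1 := fun j x => by
    have := hα2 {j} x
    rw [Finset.sum_singleton] at this
    exact (sq_le_one_iff₀ (abs_nonneg _)).1 this
  unfold TimeFreq.modelSum
  rw [← ENNReal.tsum_prod, ENNReal.tsum_eq_iSup_sum]
  -- size and density are monotone, so that finite sets of tiles suffice
  refine iSup_le fun P => ?_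
  set J : Finset ℕ := P.image fun p => p.1
  set T' : Finset TimeFreq.Tile := P.image fun p => p.2.1
  have hT'T : (T' : Set TimeFreq.Tile) ⊆ T := by
    intro s hs
    obtain ⟨p, -, rfl⟩ := Finset.mem_image.1 (Finset.mem_coe.1 hs)
    exact p.2.2
  have hsize : TimeFreq.size φ (TimeFreq.ind G) T' ≤ TimeFreq.size φ (TimeFreq.ind G) T := by
    refine iSup₂_le fun U u => iSup₂_le fun hU hu => ?_
    exact (le_iSup₂ (f := fun (_ : U ⊆ T) (_ : TimeFreq.IsPlusTree U u) =>
      ENNReal.ofReal u.I.length ^ (-1 / 2 : ℝ) *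
      (∑' s : U, ‖TimeFreq.pairing (TimeFreq.ind G) (TimeFreq.packet φ s)‖ₑ ^ 2) ^ (1 / 2 : ℝ))
      (hU.trans hT'T) hu).trans
      (le_iSup₂ (f := fun (U : Set TimeFreq.Tile) (u : TimeFreq.Tile) =>
        ⨆ (_ : U ⊆ T) (_ : TimeFreq.IsPlusTree U u), ENNReal.ofReal u.I.length ^ (-1 / 2 : ℝ) *
        (∑' s : U, ‖TimeFreq.pairing (TimeFreq.ind G) (TimeFreq.packet φ s)‖ₑ ^ 2) ^ (1 / 2 : ℝ))
        U u)
  have hdens : TimeFreq.density ν N H T' ≤ TimeFreq.density ν N H T := biSup_mono hT'T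
  set F : ℕ → TimeFreq.Tile → ℝ≥0∞ := fun j s =>
    ‖TimeFreq.pairing (TimeFreq.ind G) (TimeFreq.packet φ s) *
      TimeFreq.pairing (TimeFreq.ind H) (TimeFreq.companion φ N (α j) (lm j) (lp j) s)‖ₑ
  calc ∑ p ∈ P, F p.1 p.2.1
      = ∑ q ∈ P.image fun p => (p.1, p.2.1), F q.1 q.2 := by
        rw [Finset.sum_image]
        intro p _ q _ hpq
        simp only [Prod.mk.injEq] at hpq
        exact Prod.ext hpq.1 (Subtype.ext hpq.2)
    _ ≤ ∑ q ∈ J ×ˢ T', F q.1 q.2 := by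
        refine Finset.sum_le_sum_of_subset fun q hq => ?_
        obtain ⟨p, hp, rfl⟩ := Finset.mem_image.1 hq
        exact Finset.mem_product.2 ⟨Finset.mem_image_of_mem (fun p : ℕ × T => p.1) hp,
          Finset.mem_image_of_mem (fun p : ℕ × T => p.2.1) hp⟩
    _ = ∑ j ∈ J, ∑ s ∈ T', F j s := Finset.sum_product _ _ _
    _ ≤ C * TimeFreq.size φ (TimeFreq.ind G) T' * TimeFreq.density ν N H T' *
          ENNReal.ofReal t.I.length :=
        hfin T' t (fun s hs => hT s (hT'T hs)) N hN G H hH k hk α hαm hα1 J (hα2 J) lm lp hlm hlp hl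
    _ ≤ _ := by gcongr
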